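/- Let $0<\alpha<1$, $q>0$, let $\lambda$ be a finite Borel measure on the Euclidean unit sphere $S^{d-1}\subset\mathbb R^d$ concentrated on $S^{d-1}_+=S^{d-1}\cap[0,\infty)^d$, and let $\beta:S^{d-1}\to(0,\infty)$ be Borel measurable. Put $$\nu(E)=\int_{S^{d-1}}\int_0^\infty \mathbf 1_E(rw)\,\frac{e^{-\beta(w)r}}{r^{\alpha+1}}\,dr\,\lambda(dw).$$ An additive process is a process with independent increments that starts at $0$ almost surely, is continuous in probability and has almost surely right-continuous paths with left limits. Let $S=(S(t))_{t\ge 0}$ be an $\mathcal{E}T\alpha S$ Sato subordinator in $\mathbb R^d$ with parameters $(\alpha,\beta,\lambda)$, exponent $q$ and zero drift; that is, $S$ is an additive process, $(S(at))_{t\ge0}$ and $(a^qS(t))_{t\ge0}$ have the same law for every $a>0$, almost surely all coordinates of $S$ are nonnegative and increasing in $t$, and $S(1)$ is infinitely divisible without Gaussian part, with Lévy measure $\nu$ and zero drift, i.e. $E[e^{i\langle z,S(1)\rangle}]=\exp\{\int(e^{i\langle z,x\rangle}-1)\,\nu(dx)\}$ for $z\in\mathbb R^d$. For $l=1,\dots,d$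 let $B_l$ be a Brownian motion on $\mathbb R^{n_l}$ with drift $\mu_l$ and covariance matrix $\Sigma_l$ (symmetric positive semidefinite), with $B_1,\dots,B_d$ independent, and let $A_l$ be a real $n\times n_l$ matrix. Put $B_A(s)=\sum_{l=1}^d A_lB_l(s_l)$ for $s\in[0,\infty)^d$, and assume that the processes $S$ and $B_A$ are independent. Then $Y(t)=B_A(S(t))$, $t\ge0$, is an additive process on $\mathbb R^n$. It is pure jump: for every $t\ge0$ the law of $Y(t)$ is infinitely divisible without Gaussian part, with a Lévy measure $\nu_t^Y$ and a location vector $\gamma_t$ (for truncation to the closed unit ball) such that $\gamma_t=\int_{\|x\|\le1}x\,\nu_t^Y(dx)$ (zero drift) whenever $\int_{\|x\|\le1}\|x\|\,\nu_t^Y(dx)<\infty$. For all $t\ge0$ and $z\in\mathbb R^n$, $$E\big[e^{i\langle z,Y(t)\rangle}\big]=\exp\Big\{\Gamma(-\alpha)\int_{S^{d-1}}\Big[\big(\beta(w)-t^q\langle\log\hat\phi_A(z),w\rangle\big)^\alpha-\beta(w)^\alpha\Big]\lambda(dw)\Big\},$$ where the integral converges absolutely, the power is the principal one, $\log\hat\phi_A(z)=(\log\hat\phi_1(z),\dots,\log\hat\phi_d(z))$,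 $\langle u,w\rangle=\sum_l u_lw_l$, $\hat\phi_l$ is the characteristic function of $A_lB_l(1)$, and $\log\hat\phi_l$ is its distinguished logarithm, i.e. the continuous function $\psi_l$ with $\psi_l(0)=0$ and $e^{\psi_l}=\hat\phi_l$. -/

import Mathlib

open MeasureTheory ProbabilityTheory Filter Topology
open scoped NNReal ENNReal Matrix RealInnerProductSpace

namespace SatoSub

noncomputable section

/-- The Euclidean space of dimension `m`. -/
abbrev Euc (m : ℕ) : Type := EuclideanSpace ℝ (Fin m)

/-- The Euclidean unit sphere of the space of dimension `m`. -/
abbrev UnitSphere (m : ℕ) : Type := Metric.sphere (0 : Euc m) 1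

/-! ### Infinitely divisible laws -/

/-- `ν` is a Lévy measure: it does not charge the origin and integrates `min 1 ‖x‖ ^ 2`. -/
structure IsLevyMeasure {m : ℕ} (ν : Measure (Euc m)) : Prop where
  zero_singleton : ν {0} = 0
  lintegral_lt_top : ∫⁻ x, ENNReal.ofReal (min 1 (‖x‖ ^ 2)) ∂ν < ∞

/-- The Lévy–Khintchine integrand, with truncation to the closed unit ball. -/
def levyIntegrand {m : ℕ} (z x : Euc m) : ℂ :=
  Complex.exp ((⟪z, x⟫ : ℝ) * Complex.I) - 1 -
    (Metric.closedBall (0 : Euc m) 1).indicator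
      (fun y : Euc m => ((⟪z, y⟫ : ℝ) : ℂ) * Complex.I) x

/-- `μ` is infinitely divisible with generating triplet `(Q, ν, γ)` (Lévy–Khintchine formula):
`Q` is the Gaussian covariance matrix, `ν` the Lévy measure, and `γ` the location vector that
belongs to the truncation to the closed unit ball. -/
structure HasLevyTriplet {m : ℕ} (μ : Measure (Euc m)) (Q : Matrix (Fin m) (Fin m) ℝ)
    (ν : Measure (Euc m)) (γ : Euc m) : Prop where
  posSemidef : Q.PosSemidef
  isLevyMeasure : IsLevyMeasure ν
  charFun_eq : ∀ z : Euc m, charFun μ z =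
    Complex.exp (((⟪γ, z⟫ : ℝ) : ℂ) * Complex.I
      - (((1 / 2 : ℝ) * (z.ofLp ⬝ᵥ Q *ᵥ z.ofLp) : ℝ) : ℂ) + ∫ x, levyIntegrand z x ∂ν)

/-- The Lévy measure with spherical part `lam`, tempering function `β` and index `α`:
`ν(E) = ∫ lam(dw) ∫_0^∞ 1_E(r w) exp (-β(w) r) / r ^ (α + 1) dr`. -/
def etsLevyMeasure {d : ℕ} (α : ℝ) (β : UnitSphere d → ℝ) (lam : Measure (UnitSphere d)) :
    Measure (Euc d) :=
  ((lam.prod (volume.restrict (Set.Ioi (0 : ℝ)))).withDensity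
    (fun p => ENNReal.ofReal (Real.exp (-(β p.1) * p.2) / p.2 ^ (α + 1)))).map
    (fun p => p.2 • (p.1 : Euc d))

/-- `μ` is the exponential tempered `α`-stable law with parameters `(α, β, lam)` that has no drift:
it has no Gaussian part, its Lévy measure is `etsLevyMeasure α β lam`, and its location vector is
`γ = ∫_{‖x‖ ≤ 1} x ν(dx)`, where the integral has to converge. Equivalently, its characteristic
function is `exp (∫ (exp (i ⟨z, x⟩) - 1) ν(dx))`. -/
structure IsDriftlessETS {d : ℕ} (μ : Measure (Euc d)) (α : ℝ) (β : UnitSphere d → ℝ)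
    (lam : Measure (UnitSphere d)) : Prop where
  integrableOn : IntegrableOn (fun x : Euc d => x) (Metric.closedBall 0 1)
    (etsLevyMeasure α β lam)
  hasLevyTriplet : HasLevyTriplet μ 0 (etsLevyMeasure α β lam)
    (∫ x in Metric.closedBall (0 : Euc d) 1, x ∂(etsLevyMeasure α β lam))

/-! ### Processes -/

variable {Ω : Type*} [MeasurableSpace Ω]

/-- Additive processes: start at zero, independent increments, continuity in probability, and
almost surely right-continuous paths with left limits. -/
structure IsAdditiveProcess {m : ℕ} (X : ℝ≥0 → Ω → Euc m) (P : Measure Ω) : Prop where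
  aemeasurable : ∀ t, AEMeasurable (X t) P
  start_zero : ∀ᵐ ω ∂P, X 0 ω = 0
  indepIncrements : HasIndepIncrements X P
  stochContinuous : ∀ t, TendstoInMeasure P X (𝓝 t) (X t)
  cadlag : ∀ᵐ ω ∂P, ∀ t : ℝ≥0,
    ContinuousWithinAt (fun s => X s ω) (Set.Ici t) t ∧
      ∃ l, Tendsto (fun s => X s ω) (𝓝[<] t) (𝓝 l)

/-- The pure jump property, for an additive process: at every time the law of the process is
infinitely divisible without Gaussian part, and without drift as far as a drift is defined, which
is the case when `∫_{‖x‖ ≤ 1} ‖x‖ ν(dx) < ∞`: the drift is then `γ - ∫_{‖x‖ ≤ 1} x ν(dx)`. -/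
def IsPureJump {m : ℕ} (X : ℝ≥0 → Ω → Euc m) (P : Measure Ω) : Prop :=
  ∀ t, ∃ (ν : Measure (Euc m)) (γ : Euc m), HasLevyTriplet (P.map (X t)) 0 ν γ ∧
    (IntegrableOn (fun x : Euc m => x) (Metric.closedBall 0 1) ν →
      γ = ∫ x in Metric.closedBall (0 : Euc m) 1, x ∂ν)

/-- Sato processes with exponent `q`: additive processes that are `q`-self-similar, that is,
for every `a > 0` the processes `X (a t)` and `a ^ q X t` have the same law. -/
structure IsSatoProcess {m : ℕ} (X : ℝ≥0 → Ω → Euc m) (q : ℝ) (P : Measure Ω) : Prop where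
  isAdditiveProcess : IsAdditiveProcess X P
  selfSimilar : ∀ a : ℝ≥0, 0 < a →
    IdentDistrib (fun ω (t : ℝ≥0) => X (a * t) ω) (fun ω (t : ℝ≥0) => ((a : ℝ) ^ q) • X t ω) P P

/-- Sato subordinators: Sato processes whose coordinates have nonnegative increasing paths. -/
structure IsSatoSubordinator {m : ℕ} (X : ℝ≥0 → Ω → Euc m) (q : ℝ) (P : Measure Ω) : Prop where
  isSatoProcess : IsSatoProcess X q P
  nonneg : ∀ᵐ ω ∂P, ∀ t i, 0 ≤ X t ω i
  monotone : ∀ᵐ ω ∂P, ∀ i, Monotone (fun t => X t ω i)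

/-- `B` is a Brownian motion with drift vector `b` and covariance matrix `C`. -/
structure IsBrownianMotion {k : ℕ} (B : ℝ≥0 → Ω → Euc k) (b : Euc k)
    (C : Matrix (Fin k) (Fin k) ℝ) (P : Measure Ω) : Prop where
  posSemidef : C.PosSemidef
  start_zero : ∀ᵐ ω ∂P, B 0 ω = 0
  indepIncrements : HasIndepIncrements B P
  hasLaw_increment : ∀ s t : ℝ≥0, s ≤ t →
    HasLaw (fun ω => B t ω - B s ω)
      (multivariateGaussian (((t : ℝ) - s) • b) (((t : ℝ) - s) • C)) P
  continuous_paths : ∀ᵐ ω ∂P, Continuous (fun t => B t ω)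

/-- The image `A v` of a vector under a matrix, between Euclidean spaces. -/
def matVec {n k : ℕ} (A : Matrix (Fin n) (Fin k) ℝ) (v : Euc k) : Euc n :=
  WithLp.toLp 2 (A *ᵥ v.ofLp)

/-- The multiparameter process `B_A(s) = A₁ B₁(s₁) + ⋯ + A_d B_d(s_d)`. -/
def multiparam {d n : ℕ} {k : Fin d → ℕ} (A : ∀ l, Matrix (Fin n) (Fin (k l)) ℝ)
    (B : ∀ l, ℝ≥0 → Ω → Euc (k l)) (s : Fin d → ℝ≥0) (ω : Ω) : Euc n :=
  ∑ l, matVec (A l) (B l (s l) ω)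

/-- The subordinated process `Y(t) = B_A(S(t))`; negative coordinates of `S(t)`, which a
subordinator does not have, are replaced by zero. -/
def subordinated {d n : ℕ} (BA : (Fin d → ℝ≥0) → Ω → Euc n) (S : ℝ≥0 → Ω → Euc d)
    (t : ℝ≥0) (ω : Ω) : Euc n :=
  BA (fun l => (S t ω l).toNNReal) ω

/-! ### Logarithms of characteristic functions -/

open Classical in
/-- The distinguished logarithm of `f`: the continuous function `ψ` with `ψ 0 = 0` and
`exp ∘ ψ = f`. It is unique if it exists; where none exists the value is zero. For a
characteristic function without zeros, such as a Gaussian one, it exists. -/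
def distinguishedLog {m : ℕ} (f : Euc m → ℂ) : Euc m → ℂ :=
  if h : ∃ ψ : Euc m → ℂ, Continuous ψ ∧ ψ 0 = 0 ∧ ∀ z, Complex.exp (ψ z) = f z
  then h.choose else 0

end

end SatoSub

/-! Everything rests on averaging over the Brownian motions before averaging over `S`. Let `ψ_l` be
the characteristic exponent of `A_l B_l(1)`. Its real part is nonpositive, and by uniqueness of
continuous logarithms it is the distinguished logarithm. At a deterministic parameter `s`, the mean
of `exp(i⟨z, B_A(s)⟩)` is `exp⟨ψ(z), s⟩`; independence then gives `E exp(i⟨z, Y(t)⟩) = E exp⟨ψ(z),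
S(t)⟩` (`integral_eval_random`, `charFun_subordinated`). The same argument applied to several
increments at once transfers independence of increments from `S` to `Y`, while continuity in
probability and path regularity pass through the continuous paths of `B_A`.

Self-similarity replaces `S(t)` by `t^q S(1)`, so a Laplace transform of `S(1)` at the complex
vector `t^q ψ(z)` is needed, whereas the hypothesis only gives purely imaginary exponents. Both
sides are bounded and holomorphic along a complex line through the exponent, so Phragmén–Lindelöf
extends the formula (`integral_exp_pairing_eq`). What remains is `∫ (e^⟨u,x⟩ - 1) ν(dx)`, which
polar coordinates reduce to a one-dimensional Gamma integral (`integral_exp_sub_one_mul_tempered`,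
`laplaceExponent_ets`).

For the pure jump property, the same exponent is rewritten as `∫ E(e^{i⟨z,W(x)⟩} - 1) ν(dx)`, where
`W(x)` is a Gaussian vector with the law of `B_A(t^q x)`. The Lévy measure of `Y(t)` is thus the
mixture of these laws along `ν`, without its mass at the origin. Since `‖W(x)‖²` is of order `‖x‖`,
integrability of `min 1 ‖x‖` under `ν` is exactly what makes it a Lévy measure. Small jumps of `Y`
may fail to be absolutely integrable, so the location vector is an iterated integral, with the
Gaussian mean taken first (`exists_hasLevyTriplet_mixture`). -/

namespace SatoSub

/-! ### A Gamma integral -/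

/-- The exponential is `1`-Lipschitz on the left half-plane. -/
lemma norm_exp_sub_exp_le {x y : ℂ} (hx : x.re ≤ 0) (hy : y.re ≤ 0) :
    ‖Complex.exp x - Complex.exp y‖ ≤ ‖x - y‖ := by
  have h := (convex_halfSpace_re_le (0 : ℝ)).norm_image_sub_le_of_norm_hasDerivWithin_le
    (f := Complex.exp) (f' := Complex.exp) (C := 1)
    (fun z _ => (Complex.hasDerivAt_exp z).hasDerivWithinAt)
    (fun z hz => by
      rw [Complex.norm_exp]
      exact Real.exp_le_one_iff.2 hz) hy hx
  simpa using h

lemma norm_exp_sub_one_le_norm {x : ℂ} (hx : x.re ≤ 0) : ‖Complex.exp x - 1‖ ≤ ‖x‖ := by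
  simpa using norm_exp_sub_exp_le hx (le_refl (0 : ℂ).re)

lemma norm_exp_sub_one_le_two {x : ℂ} (hx : x.re ≤ 0) : ‖Complex.exp x - 1‖ ≤ 2 := by
  have h : ‖Complex.exp x‖ ≤ 1 := by
    rw [Complex.norm_exp]; exact Real.exp_le_one_iff.2 hx
  calc ‖Complex.exp x - 1‖ ≤ ‖Complex.exp x‖ + ‖(1 : ℂ)‖ := norm_sub_le _ _
    _ ≤ 2 := by rw [norm_one]; linarith

lemma integrableOn_exp_mul_rpow {s : ℂ} {a : ℝ} (hs : 0 < s.re) (ha : -1 < a) :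
    IntegrableOn (fun r : ℝ => Complex.exp (-s * r) * ((r ^ a : ℝ) : ℂ)) (Set.Ioi 0) := by
  have h : IntegrableOn (fun r : ℝ => r ^ a * Real.exp (-s.re * r)) (Set.Ioi 0) := by
    simpa using integrableOn_rpow_mul_exp_neg_mul_rpow (p := 1) (s := a) ha one_pos hs
  refine h.mono' ?_ ?_
  · refine ContinuousOn.aestronglyMeasurable ?_ measurableSet_Ioi
    refine ContinuousOn.mul (by fun_prop) ?_
    exact Complex.continuous_ofReal.comp_continuousOn
      (continuousOn_id.rpow_const fun x hx => Or.inl (ne_of_gt hx))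
  · filter_upwards [ae_restrict_mem measurableSet_Ioi] with r hr
    rw [norm_mul, Complex.norm_exp, Complex.norm_real, Real.norm_eq_abs,
      abs_of_nonneg (Real.rpow_nonneg (le_of_lt hr) _), mul_comm]
    simp

/-- A locally dominated integral of functions holomorphic on an open set is holomorphic. -/
lemma differentiableOn_integral_of_dominated {X : Type*} [MeasurableSpace X] {μ : Measure X}
    {F : ℂ → X → ℂ} {U : Set ℂ} (hU : IsOpen U)
    (hmeas : ∀ z, AEStronglyMeasurable (F z) μ)
    (hd : ∀ x, DifferentiableOn ℂ (fun z => F z x) U)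
    (hb : ∀ z ∈ U, ∃ bound : X → ℝ, Integrable bound μ ∧
      ∀ᶠ ε in 𝓝[>] (0 : ℝ), ∀ᵐ x ∂μ, ∀ w ∈ Metric.ball z ε, ‖F w x‖ ≤ bound x) :
    DifferentiableOn ℂ (fun z => ∫ x, F z x ∂μ) U := by
  intro z hz
  obtain ⟨bound, hbi, hbb⟩ := hb z hz
  obtain ⟨ε₁, hε₁, hball⟩ := Metric.isOpen_iff.1 hU z hz
  obtain ⟨ε, ⟨hεb, hε0 : 0 < ε⟩, hεle⟩ := ((hbb.and self_mem_nhdsWithin).and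
    (nhdsWithin_le_nhds (Iio_mem_nhds hε₁))).exists
  have hεU : Metric.ball z ε ⊆ U := (Metric.ball_subset_ball (le_of_lt hεle)).trans hball
  have hdat : ∀ x, ∀ w ∈ Metric.ball z ε, DifferentiableAt ℂ (fun z => F z x) w :=
    fun x w hw => (hd x).differentiableAt (hU.mem_nhds (hεU hw))
  have hz0 : z ∈ Metric.ball z ε := Metric.mem_ball_self hε0
  -- Cauchy's estimate dominates the derivative: circles of radius `ε / 4` about points of the ball
  -- of radius `ε / 2` stay where `bound` applies.
  have key := hasDerivAt_integral_of_dominated_loc_of_deriv_le (μ := μ) (F := F)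
    (F' := fun w x => deriv (fun z => F z x) w) (x₀ := z) (s := Metric.ball z (ε / 2))
    (bound := fun x => bound x / (ε / 4)) (Metric.ball_mem_nhds z (by positivity))
    (Eventually.of_forall hmeas)
    (hbi.mono' (hmeas z) (hεb.mono fun x hx => hx z hz0)) ?_ ?_ (hbi.div_const _) ?_
  · exact key.2.differentiableAt.differentiableWithinAt
  -- The derivative is measurable in `x` as a pointwise limit of difference quotients along the
  -- steps `1 / (n + 1)`.
  · have hseq : Tendsto (fun n : ℕ => (((1 : ℝ) / ((n : ℝ) + 1) : ℝ) : ℂ)) atTop (𝓝[≠] 0) := by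
      refine tendsto_nhdsWithin_iff.2 ⟨?_, Eventually.of_forall fun n => ?_⟩
      · exact (Complex.continuous_ofReal.tendsto' _ _ (by simp)).comp
          tendsto_one_div_add_atTop_nhds_zero_nat
      · have : (0 : ℝ) < 1 / ((n : ℝ) + 1) := by positivity
        exact Complex.ofReal_ne_zero.2 this.ne'
    refine aestronglyMeasurable_of_tendsto_ae atTop (f := fun (n : ℕ) x =>
      ((((1 : ℝ) / ((n : ℝ) + 1) : ℝ) : ℂ))⁻¹ •
        (F (z + (((1 : ℝ) / ((n : ℝ) + 1) : ℝ) : ℂ)) x - F z x))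
      (fun n => ?_) ?_
    · have h := ((hmeas (z + (((1 : ℝ) / ((n : ℝ) + 1) : ℝ) : ℂ))).sub (hmeas z)).const_smul
        ((((1 : ℝ) / ((n : ℝ) + 1) : ℝ) : ℂ))⁻¹
      exact h
    refine Eventually.of_forall fun x => ?_
    exact ((hasDerivAt_iff_tendsto_slope_zero.1 (hdat x z hz0).hasDerivAt)).comp hseq
  · filter_upwards [hεb] with x hx w hw
    refine Complex.norm_deriv_le_of_forall_mem_sphere_norm_le (by positivity) ?_ ?_
    · refine DifferentiableOn.diffContOnCl fun y hy => (hdat x y ?_).differentiableWithinAt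
      have hy := Metric.closure_ball_subset_closedBall hy
      rw [Metric.mem_closedBall] at hy
      rw [Metric.mem_ball] at hw ⊢
      linarith [dist_triangle y w z]
    · intro y hy
      refine hx y ?_
      rw [Metric.mem_sphere] at hy
      rw [Metric.mem_ball] at hw ⊢
      linarith [dist_triangle y w z]
  · refine Eventually.of_forall fun x w hw => ?_
    exact (hdat x w (Metric.ball_subset_ball (by linarith) hw)).hasDerivAt

/-- Both sides are holomorphic on the right half-plane and agree on the positive reals by Euler's
integral. The points `1 + 1 / (n + 1)` accumulate at `1`, so the identity theorem applies. -/
lemma integral_exp_mul_rpow {s : ℂ} {α : ℝ} (hs : 0 < s.re) (hα : α < 1) :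
    ∫ r in Set.Ioi (0 : ℝ), Complex.exp (-s * r) * ((r ^ (-α) : ℝ) : ℂ)
      = s ^ ((α : ℂ) - 1) * Real.Gamma (1 - α) := by
  have hU : IsOpen {s : ℂ | 0 < s.re} := isOpen_lt continuous_const Complex.continuous_re
  have hf : DifferentiableOn ℂ (fun s : ℂ =>
      ∫ r in Set.Ioi (0 : ℝ), Complex.exp (-s * r) * ((r ^ (-α) : ℝ) : ℂ)) {s : ℂ | 0 < s.re} := by
    refine differentiableOn_integral_of_dominated hU
      (fun z => Measurable.aestronglyMeasurable (by fun_prop)) (fun r => by fun_prop) ?_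
    intro z hz
    have hz : 0 < z.re := hz
    refine ⟨fun r => ‖Complex.exp (-((z.re / 2 : ℝ) : ℂ) * r) * ((r ^ (-α) : ℝ) : ℂ)‖,
      (integrableOn_exp_mul_rpow (s := ((z.re / 2 : ℝ) : ℂ)) (a := -α) (by simpa using hz)
        (by linarith)).norm, ?_⟩
    filter_upwards [nhdsWithin_le_nhds (Iio_mem_nhds (half_pos hz))] with ε hε
    filter_upwards [ae_restrict_mem measurableSet_Ioi] with r hr w hw
    have hr : 0 < r := hr
    rw [norm_mul, norm_mul, Complex.norm_exp, Complex.norm_exp]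
    gcongr ?_ * _
    refine Real.exp_le_exp.2 ?_
    have h1 : |z.re - w.re| < z.re / 2 := by
      have := Complex.abs_re_le_norm (z - w)
      rw [Metric.mem_ball, dist_comm, dist_eq_norm] at hw
      rw [Complex.sub_re] at this
      exact this.trans_lt (hw.trans hε)
    have h2 := (abs_lt.1 h1).2
    simp
    nlinarith
  have hg : DifferentiableOn ℂ (fun s : ℂ => s ^ ((α : ℂ) - 1) * Real.Gamma (1 - α))
      {s : ℂ | 0 < s.re} := by
    intro z hz
    exact ((differentiableAt_id.cpow_const (Or.inl hz)).mul_const _).differentiableWithinAt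
  have hconv : IsPreconnected {s : ℂ | 0 < s.re} := (convex_halfSpace_re_gt 0).isPreconnected
  refine (hf.analyticOnNhd hU).eqOn_of_preconnected_of_frequently_eq (hg.analyticOnNhd hU) hconv
    (z₀ := 1) (by simp) ?_ hs
  have hreal : ∀ t : ℝ, 0 < t →
      ∫ r in Set.Ioi (0 : ℝ), Complex.exp (-(t : ℂ) * r) * ((r ^ (-α) : ℝ) : ℂ)
        = (t : ℂ) ^ ((α : ℂ) - 1) * Real.Gamma (1 - α) := by
    intro t ht
    have h := Complex.integral_cpow_mul_exp_neg_mul_Ioi (a := ((1 - α : ℝ) : ℂ)) (r := t)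
      (by simpa using hα) ht
    have harg : (t : ℂ).arg ≠ Real.pi := by
      rw [Complex.arg_ofReal_of_nonneg ht.le]; exact Real.pi_pos.ne
    have e : (1 / (t : ℂ)) ^ (((1 - α : ℝ) : ℂ)) = (t : ℂ) ^ ((α : ℂ) - 1) := by
      rw [one_div, Complex.inv_cpow _ _ harg, ← Complex.cpow_neg]
      congr 1; push_cast; ring
    rw [← Complex.Gamma_ofReal, ← e, ← h]
    refine setIntegral_congr_fun measurableSet_Ioi fun r hr => ?_
    rw [Complex.ofReal_cpow (le_of_lt hr), mul_comm]
    push_cast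
    ring_nf
  have hseq : Tendsto (fun n : ℕ => ((1 + (1 : ℝ) / ((n : ℝ) + 1) : ℝ) : ℂ)) atTop (𝓝[≠] 1) := by
    refine tendsto_nhdsWithin_iff.2 ⟨?_, Eventually.of_forall fun n => ?_⟩
    · exact (((Complex.continuous_ofReal.comp (continuous_const.add continuous_id)).tendsto' _ _
        (by simp)).comp tendsto_one_div_add_atTop_nhds_zero_nat)
    · have h0 : (0 : ℝ) < 1 / ((n : ℝ) + 1) := by positivity
      intro h
      have h : ((1 + (1 : ℝ) / ((n : ℝ) + 1) : ℝ) : ℂ) = ((1 : ℝ) : ℂ) := by simpa using h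
      have := Complex.ofReal_injective h
      linarith
  exact hseq.frequently (Frequently.of_forall fun n => hreal _ (by positivity))

/-- `∫_0^∞ (e^{u r} - 1) e^{-b r} r^{-α-1} dr = Γ(-α) ((b - u)^α - b^α)` for `Re u ≤ 0 < b`. -/
lemma integral_exp_sub_one_mul_tempered {α b : ℝ} {u : ℂ} (hα0 : 0 < α) (hα1 : α < 1)
    (hb : 0 < b) (hu : u.re ≤ 0) :
    ∫ r in Set.Ioi (0 : ℝ), (Real.exp (-b * r) / r ^ (α + 1)) • (Complex.exp (r * u) - 1)
      = Real.Gamma (-α) * (((b : ℂ) - u) ^ (α : ℂ) - ((b ^ α : ℝ) : ℂ)) := by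
  set s : ℂ := b - u with hs
  have hsre : 0 < s.re := by simp [hs]; linarith
  have hs0 : s ≠ 0 := by intro h; rw [h] at hsre; simp at hsre
  have hbc : 0 < ((b : ℂ)).re := by simpa
  have hb0 : (b : ℂ) ≠ 0 := by exact_mod_cast hb.ne'
  let D : ℝ → ℂ := fun r => Complex.exp (-s * r) - Complex.exp (-b * r)
  have hD : ∀ r : ℝ, 0 ≤ r → ‖D r‖ ≤ ‖u‖ * r := by
    intro r hr
    have := norm_exp_sub_exp_le (x := -s * r) (y := -b * r) (by simp; positivity)
      (by simp; positivity)
    refine this.trans (le_of_eq ?_)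
    rw [show -s * (r : ℂ) - -b * r = u * r by rw [hs]; ring, norm_mul, Complex.norm_real,
      Real.norm_of_nonneg hr]
  -- Integration by parts: `F` vanishes at `0`, because `D` is `O(r)` and `α < 1`, and at infinity.
  -- Its derivative consists of two Gamma integrands and `-α G`, so `∫ F' = 0` determines `∫ G`;
  -- finally `Γ(1 - α) = -α Γ(-α)`.
  let F : ℝ → ℂ := fun r => D r * ((r ^ (-α) : ℝ) : ℂ)
  let G : ℝ → ℂ := fun r => (Real.exp (-b * r) / r ^ (α + 1)) • (Complex.exp (r * u) - 1)
  have hG : ∀ r : ℝ, 0 < r → G r = D r * ((r ^ (-α - 1) : ℝ) : ℂ) := by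
    intro r hr
    simp only [G, D, Complex.real_smul]
    rw [show -α - 1 = -(α + 1) by ring, Real.rpow_neg hr.le,
      show -s * (r : ℂ) = (-b * r) + r * u by rw [hs]; ring, Complex.exp_add]
    push_cast
    ring
  have hGint : IntegrableOn G (Set.Ioi 0) := by
    have h : IntegrableOn (fun r : ℝ => ‖u‖ * (r ^ (-α) * Real.exp (-b * r))) (Set.Ioi 0) := by
      refine Integrable.const_mul ?_ _
      have h0 := integrableOn_rpow_mul_exp_neg_mul_rpow (p := 1) (s := -α) (by linarith) one_pos hb
      simp only [Real.rpow_one] at h0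
      exact h0
    refine h.mono' ?_ ?_
    · exact Measurable.aestronglyMeasurable (by fun_prop)
    · filter_upwards [ae_restrict_mem measurableSet_Ioi] with r hr
      have hr : 0 < r := hr
      have h1 := norm_exp_sub_one_le_norm (x := r * u) (by
        simp only [Complex.mul_re, Complex.ofReal_re, Complex.ofReal_im, zero_mul, sub_zero]
        exact mul_nonpos_of_nonneg_of_nonpos hr.le hu)
      rw [norm_mul, Complex.norm_real, Real.norm_of_nonneg hr.le] at h1
      rw [norm_smul, Real.norm_of_nonneg (by positivity)]
      calc _ ≤ Real.exp (-b * r) / r ^ (α + 1) * (r * ‖u‖) := by gcongr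
        _ = _ := by
          rw [show -α = -(α + 1) + 1 by ring, Real.rpow_add hr (-(α + 1)) 1, Real.rpow_neg hr.le,
            Real.rpow_one]
          ring
  let F' : ℝ → ℂ := fun r => (-s * (Complex.exp (-s * r) * ((r ^ (-α) : ℝ) : ℂ))
    + b * (Complex.exp (-b * r) * ((r ^ (-α) : ℝ) : ℂ))) + (-α : ℝ) * G r
  have hderiv : ∀ r ∈ Set.Ioi (0 : ℝ), HasDerivAt F (F' r) r := by
    intro r hr
    have hr : 0 < r := hr
    have h1 : HasDerivAt D (Complex.exp (-s * r) * (-s * 1) - Complex.exp (-b * r) * (-b * 1)) r := by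
      have hx : HasDerivAt (fun x : ℝ => (x : ℂ)) 1 r := Complex.ofRealCLM.hasDerivAt
      exact ((hx.const_mul (-s)).cexp).sub ((hx.const_mul (-(b : ℂ))).cexp)
    have h2 : HasDerivAt (fun x : ℝ => ((x ^ (-α) : ℝ) : ℂ)) ((-α * r ^ (-α - 1) : ℝ) : ℂ) r :=
      (Real.hasDerivAt_rpow_const (Or.inl hr.ne')).ofReal_comp
    refine (h1.mul h2).congr_deriv ?_
    simp only [F', hG r hr]
    push_cast
    ring
  have i1 := integrableOn_exp_mul_rpow (s := s) (a := -α) hsre (by linarith)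
  have i2 := integrableOn_exp_mul_rpow (s := (b : ℂ)) (a := -α) hbc (by linarith)
  have hF'int : IntegrableOn F' (Set.Ioi 0) :=
    ((i1.const_mul (-s)).add (i2.const_mul (b : ℂ))).add (hGint.const_mul _)
  have hFbound : ∀ r : ℝ, 0 ≤ r → ‖F r‖ ≤ ‖u‖ * r ^ (1 - α) := by
    intro r hr
    rcases hr.eq_or_lt with rfl | hr
    · have : F 0 = 0 := by simp [F, D]
      rw [this, norm_zero]; positivity
    · simp only [F]
      rw [norm_mul, Complex.norm_real, Real.norm_of_nonneg (Real.rpow_nonneg hr.le _)]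
      calc _ ≤ ‖u‖ * r * r ^ (-α) := by gcongr; exact hD r hr.le
        _ = _ := by rw [sub_eq_add_neg, Real.rpow_add hr, Real.rpow_one]; ring
  have hcont : ContinuousWithinAt F (Set.Ici 0) 0 := by
    have h0 : F 0 = 0 := by simp [F, D]
    unfold ContinuousWithinAt
    rw [h0]
    refine squeeze_zero_norm' (a := fun r : ℝ => ‖u‖ * r ^ (1 - α)) ?_ ?_
    · filter_upwards [self_mem_nhdsWithin] with r hr using hFbound r hr
    · have : ContinuousAt (fun r : ℝ => ‖u‖ * r ^ (1 - α)) 0 :=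
        continuousAt_const.mul (Real.continuousAt_rpow_const _ _ (Or.inr (by linarith)))
      have h := this.tendsto
      rw [Real.zero_rpow (by linarith), mul_zero] at h
      exact h.mono_left nhdsWithin_le_nhds
  have htop : Tendsto F atTop (𝓝 0) := by
    have hb2 : ∀ r : ℝ, 0 < r → ‖F r‖ ≤ 2 * r ^ (-α) := by
      intro r hr
      simp only [F]
      rw [norm_mul, Complex.norm_real, Real.norm_of_nonneg (Real.rpow_nonneg hr.le _)]
      gcongr
      refine (norm_sub_le _ _).trans ?_
      rw [Complex.norm_exp, Complex.norm_exp]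
      have h1 : Real.exp ((-s * (r : ℂ)).re) ≤ 1 := Real.exp_le_one_iff.2 (by simp; positivity)
      have h2 : Real.exp ((-(b : ℂ) * (r : ℂ)).re) ≤ 1 := Real.exp_le_one_iff.2 (by simp; positivity)
      linarith
    refine squeeze_zero_norm' (a := fun r : ℝ => 2 * r ^ (-α)) ?_ ?_
    · filter_upwards [eventually_gt_atTop 0] with r hr using hb2 r hr
    · simpa using (tendsto_rpow_neg_atTop hα0).const_mul 2
  have key := integral_Ioi_of_hasDerivAt_of_tendsto hcont hderiv hF'int htop
  have h0 : F 0 = 0 := by simp [F, D]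
  rw [h0, sub_zero] at key
  have hsplit := (integral_add (((i1.const_mul (-s)).add (i2.const_mul (b : ℂ))))
    (hGint.const_mul (((-α : ℝ) : ℂ)))).trans
    (congrArg (· + _) (integral_add (i1.const_mul (-s)) (i2.const_mul (b : ℂ))))
  have key := hsplit.symm.trans key
  beta_reduce at key
  rw [integral_const_mul, integral_const_mul, integral_const_mul,
    integral_exp_mul_rpow hsre hα1, integral_exp_mul_rpow hbc hα1] at key
  have hgam : (Real.Gamma (1 - α) : ℝ) = -α * Real.Gamma (-α) := by
    rw [← Real.Gamma_add_one (by linarith : -α ≠ 0)]; congr 1; ring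
  have p1 : s * s ^ ((α : ℂ) - 1) = s ^ (α : ℂ) := by
    rw [Complex.cpow_sub _ _ hs0, Complex.cpow_one]; field_simp
  have p2 : (b : ℂ) * (b : ℂ) ^ ((α : ℂ) - 1) = ((b ^ α : ℝ) : ℂ) := by
    rw [Complex.cpow_sub _ _ hb0, Complex.cpow_one, Complex.ofReal_cpow hb.le]; field_simp
  have hα : (α : ℂ) ≠ 0 := by exact_mod_cast hα0.ne'
  rw [hgam] at key
  push_cast at key
  have : (α : ℂ) * ∫ r in Set.Ioi (0 : ℝ), G r
      = α * (Real.Gamma (-α) * (s ^ (α : ℂ) - ((b ^ α : ℝ) : ℂ))) := by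
    rw [← p1, ← p2]
    linear_combination -key
  exact mul_left_cancel₀ hα this

end SatoSub

namespace SatoSub

/-! ### The Laplace exponent -/

/-- The bilinear pairing `∑ l, u l * x l` of a complex vector with a real vector. -/
noncomputable def pairing {d : ℕ} (u : Fin d → ℂ) (x : Euc d) : ℂ := ∑ l, u l * ((x l : ℝ) : ℂ)

section pairing
variable {d : ℕ}

@[fun_prop]
lemma continuous_pairing (u : Fin d → ℂ) : Continuous (pairing u) := by
  unfold pairing; fun_prop

lemma norm_pairing_le (u : Fin d → ℂ) (x : Euc d) : ‖pairing u x‖ ≤ (∑ l, ‖u l‖) * ‖x‖ := by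
  rw [Finset.sum_mul]
  refine norm_sum_le_of_le _ fun l _ => ?_
  rw [norm_mul, Complex.norm_real]
  gcongr
  exact PiLp.norm_apply_le x l

lemma re_pairing_nonpos {u : Fin d → ℂ} {x : Euc d} (hu : ∀ l, (u l).re ≤ 0)
    (hx : ∀ l, 0 ≤ x l) : (pairing u x).re ≤ 0 := by
  unfold pairing
  rw [Complex.re_sum]
  refine Finset.sum_nonpos fun l _ => ?_
  rw [Complex.re_mul_ofReal]
  exact mul_nonpos_of_nonpos_of_nonneg (hu l) (hx l)

lemma pairing_smul (u : Fin d → ℂ) (c : ℝ) (x : Euc d) :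
    pairing u (c • x) = c * pairing u x := by
  simp only [pairing, Finset.mul_sum, PiLp.smul_apply, smul_eq_mul, Complex.ofReal_mul]
  exact Finset.sum_congr rfl fun l _ => by ring

lemma pairing_smul_left (u : Fin d → ℂ) (c : ℂ) (x : Euc d) :
    pairing (fun l => c * u l) x = c * pairing u x := by
  simp only [pairing, Finset.mul_sum, mul_assoc]

lemma pairing_add_left (u v : Fin d → ℂ) (x : Euc d) :
    pairing (fun l => u l + v l) x = pairing u x + pairing v x := by
  simp only [pairing, add_mul, Finset.sum_add_distrib]

lemma pairing_ofReal_mul_I (z x : Euc d) :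
    pairing (fun l => ((z l : ℝ) : ℂ) * Complex.I) x = ((⟪z, x⟫ : ℝ) : ℂ) * Complex.I := by
  simp only [pairing, PiLp.inner_apply, RCLike.inner_apply, conj_trivial]
  push_cast
  rw [Finset.sum_mul]
  exact Finset.sum_congr rfl fun l _ => by ring

/-- The bound on `exp (pairing u x) - 1` against which a subordinator's Lévy measure integrates. -/
lemma norm_exp_pairing_sub_one_le {u : Fin d → ℂ} {x : Euc d} (hu : ∀ l, (u l).re ≤ 0)
    (hx : ∀ l, 0 ≤ x l) :
    ‖Complex.exp (pairing u x) - 1‖ ≤ (2 + ∑ l, ‖u l‖) * min 1 ‖x‖ := by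
  have hre := re_pairing_nonpos hu hx
  have h0 : 0 ≤ ∑ l, ‖u l‖ := by positivity
  rcases le_total 1 ‖x‖ with h | h
  · rw [min_eq_left h]
    linarith [norm_exp_sub_one_le_two hre]
  · rw [min_eq_right h]
    have := (norm_exp_sub_one_le_norm hre).trans (norm_pairing_le u x)
    nlinarith [norm_nonneg x]

variable {ν : Measure (Euc d)}

lemma integrable_exp_pairing_sub_one (hν0 : ∀ᵐ x ∂ν, ∀ l, 0 ≤ x l)
    (hν : Integrable (fun x : Euc d => min 1 ‖x‖) ν) {u : Fin d → ℂ} (hu : ∀ l, (u l).re ≤ 0) :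
    Integrable (fun x => Complex.exp (pairing u x) - 1) ν := by
  refine (hν.const_mul (2 + ∑ l, ‖u l‖)).mono' ?_ ?_
  · exact Continuous.aestronglyMeasurable (by fun_prop)
  · filter_upwards [hν0] with x hx using norm_exp_pairing_sub_one_le hu hx

lemma re_integral_exp_pairing_sub_one_nonpos (hν0 : ∀ᵐ x ∂ν, ∀ l, 0 ≤ x l)
    (hν : Integrable (fun x : Euc d => min 1 ‖x‖) ν) {u : Fin d → ℂ} (hu : ∀ l, (u l).re ≤ 0) :
    (∫ x, (Complex.exp (pairing u x) - 1) ∂ν).re ≤ 0 := by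
  have h := integral_re (integrable_exp_pairing_sub_one hν0 hν hu)
  simp only [RCLike.re_eq_complex_re] at h
  rw [← h]
  refine integral_nonpos_of_ae ?_
  filter_upwards [hν0] with x hx
  have h1 := re_pairing_nonpos hu hx
  have h2 := Complex.re_le_norm (Complex.exp (pairing u x))
  rw [Complex.norm_exp] at h2
  have h3 := Real.exp_le_one_iff.2 h1
  simp
  linarith

/-- The segment of exponents through `i b` in direction `a`. -/
lemma pairing_ray (a b : Fin d → ℝ) (ζ : ℂ) (x : Euc d) :
    pairing (fun l => ζ * (a l : ℂ) + Complex.I * (b l : ℂ)) x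
      = ζ * pairing (fun l => (a l : ℂ)) x + Complex.I * pairing (fun l => (b l : ℂ)) x := by
  rw [← pairing_smul_left, ← pairing_smul_left, ← pairing_add_left]

/-- Integrals of `exp (ζ A + i B) - c`, `A ≤ 0`, dominated locally uniformly in `ζ`, are
continuous on the closed right half-plane and holomorphic inside. -/
lemma diffContOnCl_integral_exp_pairing {κ : Measure (Euc d)} {a b : Fin d → ℝ} {c : ℂ}
    {M : Euc d → ℝ} (hM : Integrable M κ)
    (hMb : ∀ᵐ x ∂κ, ∀ ζ : ℂ, 0 ≤ ζ.re → ‖Complex.exp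
      (pairing (fun l => ζ * (a l : ℂ) + Complex.I * (b l : ℂ)) x) - c‖ ≤ (1 + ‖ζ‖) * M x) :
    DiffContOnCl ℂ (fun ζ : ℂ => ∫ x, (Complex.exp
      (pairing (fun l => ζ * (a l : ℂ) + Complex.I * (b l : ℂ)) x) - c) ∂κ) {ζ | 0 < ζ.re} := by
  have hM0 : ∀ᵐ x ∂κ, 0 ≤ M x := by
    filter_upwards [hMb] with x hx
    have := (norm_nonneg _).trans (hx 0 le_rfl)
    simpa using this
  have hmeas : ∀ ζ : ℂ, AEStronglyMeasurable (fun x => Complex.exp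
      (pairing (fun l => ζ * (a l : ℂ) + Complex.I * (b l : ℂ)) x) - c) κ :=
    fun ζ => Continuous.aestronglyMeasurable (by fun_prop)
  have hcont : ∀ x : Euc d, Continuous (fun ζ : ℂ => Complex.exp
      (pairing (fun l => ζ * (a l : ℂ) + Complex.I * (b l : ℂ)) x) - c) := by
    intro x
    simp only [pairing_ray]
    fun_prop
  refine ⟨differentiableOn_integral_of_dominated
    (isOpen_lt continuous_const Complex.continuous_re) hmeas (fun x => ?_) ?_, ?_⟩
  · simp only [pairing_ray]
    fun_prop
  · intro z hz
    have hz : 0 < z.re := hz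
    refine ⟨fun x => (2 + ‖z‖) * M x, hM.const_mul _, ?_⟩
    filter_upwards [nhdsWithin_le_nhds (Iio_mem_nhds hz),
      nhdsWithin_le_nhds (Iio_mem_nhds one_pos)] with ε hε hε1
    filter_upwards [hMb, hM0] with x hx hx0 w hw
    have hw1 : ‖w - z‖ < ε := by rwa [Metric.mem_ball, dist_eq_norm] at hw
    have hre : |w.re - z.re| < ε := by
      rw [← Complex.sub_re]; exact (Complex.abs_re_le_norm _).trans_lt hw1
    refine (hx w ?_).trans ?_
    · have := (abs_lt.1 hre).1
      have hε : ε < z.re := hε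
      linarith
    · have h1 : ‖w‖ ≤ ‖z‖ + ‖w - z‖ := by
        simpa using norm_add_le z (w - z)
      have hε1 : ε < 1 := hε1
      gcongr ?_ * _
      linarith
  · rw [Complex.closure_setOfPred_lt_re]
    intro z hz
    refine continuousWithinAt_of_dominated (bound := fun x => (2 + ‖z‖) * M x)
      (Eventually.of_forall hmeas) ?_ (hM.const_mul _)
      (Eventually.of_forall fun x => (hcont x).continuousWithinAt)
    filter_upwards [self_mem_nhdsWithin, nhdsWithin_le_nhds (Metric.ball_mem_nhds z one_pos)]
      with w hw hw1
    rw [Metric.mem_ball, dist_eq_norm] at hw1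
    filter_upwards [hMb, hM0] with x hx hx0
    refine (hx w hw).trans ?_
    have h1 : ‖w‖ ≤ ‖z‖ + ‖w - z‖ := by simpa using norm_add_le z (w - z)
    gcongr ?_ * _
    linarith

/-- The Laplace transform of a law on the nonnegative orthant with a driftless Lévy–Khintchine
formula extends from imaginary to all exponents with nonpositive real parts. -/
lemma integral_exp_pairing_eq {μ : Measure (Euc d)} [IsProbabilityMeasure μ]
    (hμ0 : ∀ᵐ x ∂μ, ∀ l, 0 ≤ x l) (hν0 : ∀ᵐ x ∂ν, ∀ l, 0 ≤ x l)
    (hν : Integrable (fun x : Euc d => min 1 ‖x‖) ν)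
    (hchar : ∀ z : Euc d, charFun μ z
      = Complex.exp (∫ x, (Complex.exp (((⟪z, x⟫ : ℝ) : ℂ) * Complex.I) - 1) ∂ν))
    {u : Fin d → ℂ} (hu : ∀ l, (u l).re ≤ 0) :
    ∫ x, Complex.exp (pairing u x) ∂μ
      = Complex.exp (∫ x, (Complex.exp (pairing u x) - 1) ∂ν) := by
  let a : Fin d → ℝ := fun l => (u l).re
  let b : Fin d → ℝ := fun l => (u l).im
  -- The line `v` meets `u` at `ζ = 1` and is purely imaginary on the imaginary axis, where `hchar`
  -- applies. For `Re ζ ≥ 0` it keeps nonpositive real parts.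
  let v : ℂ → Fin d → ℂ := fun ζ l => ζ * (a l : ℂ) + Complex.I * (b l : ℂ)
  have hv : ∀ ζ : ℂ, 0 ≤ ζ.re → ∀ l, (v ζ l).re ≤ 0 := by
    intro ζ hζ l
    simpa [v] using mul_nonpos_of_nonneg_of_nonpos hζ (hu l)
  have hv1 : v 1 = u := by
    funext l
    simp only [v, a, b, one_mul]
    rw [mul_comm]
    exact Complex.re_add_im (u l)
  let F : ℂ → ℂ := fun ζ => ∫ x, (Complex.exp (pairing (v ζ) x) - 0) ∂μ
  let H : ℂ → ℂ := fun ζ => ∫ x, (Complex.exp (pairing (v ζ) x) - 1) ∂ν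
  have hnorm : ∀ ζ : ℂ, 0 ≤ ζ.re → ∀ x : Euc d, (∀ l, 0 ≤ x l) →
      ‖Complex.exp (pairing (v ζ) x)‖ ≤ 1 := by
    intro ζ hζ x hx
    rw [Complex.norm_exp]
    exact Real.exp_le_one_iff.2 (re_pairing_nonpos (hv ζ hζ) hx)
  have hF : DiffContOnCl ℂ F {ζ | 0 < ζ.re} := by
    refine diffContOnCl_integral_exp_pairing (M := fun _ => 1) (integrable_const _) ?_
    filter_upwards [hμ0] with x hx ζ hζ
    rw [sub_zero]
    refine (hnorm ζ hζ x hx).trans ?_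
    linarith [norm_nonneg ζ]
  have hH : DiffContOnCl ℂ H {ζ | 0 < ζ.re} := by
    refine diffContOnCl_integral_exp_pairing
      (M := fun x => (2 + (∑ l, |a l| + ∑ l, |b l|)) * min 1 ‖x‖) (hν.const_mul _) ?_
    filter_upwards [hν0] with x hx ζ hζ
    refine (norm_exp_pairing_sub_one_le (hv ζ hζ) hx).trans ?_
    rw [← mul_assoc]
    gcongr
    have h1 : ∑ l, ‖v ζ l‖ ≤ ‖ζ‖ * ∑ l, |a l| + ∑ l, |b l| := by
      rw [Finset.mul_sum, ← Finset.sum_add_distrib]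
      refine Finset.sum_le_sum fun l _ => (norm_add_le _ _).trans ?_
      simp
    have ha : 0 ≤ ∑ l, |a l| := by positivity
    have hb : 0 ≤ ∑ l, |b l| := by positivity
    nlinarith [norm_nonneg ζ]
  have hFle : ∀ ζ : ℂ, 0 ≤ ζ.re → ‖F ζ‖ ≤ 1 := by
    intro ζ hζ
    refine (norm_integral_le_of_norm_le_const (C := 1) ?_).trans (by simp)
    filter_upwards [hμ0] with x hx
    simpa using hnorm ζ hζ x hx
  have hHle : ∀ ζ : ℂ, 0 ≤ ζ.re → ‖Complex.exp (H ζ)‖ ≤ 1 := by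
    intro ζ hζ
    rw [Complex.norm_exp]
    exact Real.exp_le_one_iff.2 (re_integral_exp_pairing_sub_one_nonpos hν0 hν (hv ζ hζ))
  have hdiff : ∀ ζ : ℂ, 0 ≤ ζ.re → ‖F ζ - Complex.exp (H ζ)‖ ≤ 2 := fun ζ hζ =>
    (norm_sub_le _ _).trans (by linarith [hFle ζ hζ, hHle ζ hζ])
  have hD : DiffContOnCl ℂ (fun ζ => F ζ - Complex.exp (H ζ)) {ζ | 0 < ζ.re} :=
    hF.sub (Complex.differentiable_exp.comp_diffContOnCl hH)
  have himag : ∀ y : ℝ, ‖F (y * Complex.I) - Complex.exp (H (y * Complex.I))‖ ≤ 0 := by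
    intro y
    let z : Euc d := WithLp.toLp 2 fun l => y * a l + b l
    have hz : v (y * Complex.I) = fun l => ((z l : ℝ) : ℂ) * Complex.I := by
      funext l
      simp only [v, z]
      push_cast
      ring
    simp only [F, H, hz, pairing_ofReal_mul_I, sub_zero]
    rw [← hchar, charFun_apply]
    simp_rw [real_inner_comm z]
    simp
  -- The difference is bounded by `2` on the half-plane and zero on its boundary, hence zero at `1`.
  -- The growth data, exponent `1 < 2` with coefficient `0`, express plain boundedness.
  have key := PhragmenLindelof.right_half_plane_of_bounded_on_real hD
    ⟨1, by norm_num, 0, Asymptotics.IsBigO.of_bound 2 ?_⟩ ?_ himag (z := 1) (by simp)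
  · have h0 : F 1 - Complex.exp (H 1) = 0 := norm_le_zero_iff.1 key
    simp only [F, H, hv1, sub_zero] at h0
    exact sub_eq_zero.1 h0
  · filter_upwards [mem_inf_of_right (mem_principal_self _)] with ζ hζ
    simpa using hdiff ζ (le_of_lt hζ)
  · refine isBoundedUnder_of_eventually_le (a := 2) ?_
    filter_upwards [eventually_ge_atTop 0] with x hx
    exact hdiff x (by simpa using hx)

end pairing
end SatoSub

namespace SatoSub

/-! ### Driftless infinitely divisible laws -/

/-- When the small jumps are absolutely integrable, the compensator may be integrated on its own and
cancels the driftless location vector. This removes the truncation from the Lévy–Khintchine formula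
of `S(1)`. -/
lemma integral_exp_inner_sub_one {m : ℕ} {ν : Measure (Euc m)} {z : Euc m}
    (h1 : IntegrableOn (fun x : Euc m => x) (Metric.closedBall 0 1) ν)
    (h2 : Integrable (levyIntegrand z) ν) :
    ∫ x, (Complex.exp (((⟪z, x⟫ : ℝ) : ℂ) * Complex.I) - 1) ∂ν
      = ((⟪∫ x in Metric.closedBall (0 : Euc m) 1, x ∂ν, z⟫ : ℝ) : ℂ) * Complex.I
        + ∫ x, levyIntegrand z x ∂ν := by
  have hi : IntegrableOn (fun x : Euc m => ((⟪z, x⟫ : ℝ) : ℂ) * Complex.I)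
      (Metric.closedBall 0 1) ν := ((h1.const_inner z).ofReal (𝕜 := ℂ)).mul_const _
  have e : ((⟪∫ x in Metric.closedBall (0 : Euc m) 1, x ∂ν, z⟫ : ℝ) : ℂ) * Complex.I
      = ∫ x, (Metric.closedBall (0 : Euc m) 1).indicator
          (fun y : Euc m => ((⟪z, y⟫ : ℝ) : ℂ) * Complex.I) x ∂ν := by
    rw [integral_indicator Metric.isClosed_closedBall.measurableSet, integral_mul_const,
      integral_complex_ofReal, real_inner_comm, ← integral_inner h1]
  rw [e, ← integral_add (hi.integrable_indicator Metric.isClosed_closedBall.measurableSet) h2]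
  refine integral_congr_ae (Eventually.of_forall fun x => ?_)
  simp [levyIntegrand]

lemma measurable_levyIntegrand {m : ℕ} (z : Euc m) : Measurable (levyIntegrand z) := by
  unfold levyIntegrand
  refine Measurable.sub (by fun_prop) (Measurable.indicator (by fun_prop)
    Metric.isClosed_closedBall.measurableSet)

/-- Second-order bound on the exponential. -/
lemma norm_exp_ofReal_mul_I_sub_le (t : ℝ) :
    ‖Complex.exp ((t : ℂ) * Complex.I) - 1 - (t : ℂ) * Complex.I‖ ≤ 2 * t ^ 2 := by
  have hn : ‖(t : ℂ) * Complex.I‖ = |t| := by simp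
  rw [← sq_abs]
  rcases le_total |t| 1 with h | h
  · refine (Complex.norm_exp_sub_one_sub_id_le (by rwa [hn])).trans ?_
    rw [hn]
    nlinarith [sq_nonneg |t|]
  · have h1 := norm_exp_sub_one_le_norm (x := (t : ℂ) * Complex.I) (by simp)
    refine (norm_sub_le _ _).trans ?_
    rw [hn] at h1 ⊢
    nlinarith

lemma norm_levyIntegrand_le {m : ℕ} (z x : Euc m) :
    ‖levyIntegrand z x‖ ≤ (2 + 2 * ‖z‖ ^ 2) * min 1 (‖x‖ ^ 2) := by
  unfold levyIntegrand
  by_cases h : ‖x‖ ≤ 1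
  · rw [Set.indicator_of_mem (by simpa using h), min_eq_right (by nlinarith [norm_nonneg x])]
    refine (norm_exp_ofReal_mul_I_sub_le _).trans ?_
    have := abs_real_inner_le_norm z x
    rw [← sq_abs]
    calc _ ≤ 2 * (‖z‖ * ‖x‖) ^ 2 := by gcongr
      _ ≤ _ := by rw [mul_pow]; nlinarith [sq_nonneg ‖x‖]
  · rw [Set.indicator_of_notMem (by simpa using h), sub_zero,
      min_eq_left (by nlinarith [norm_nonneg x])]
    have := norm_exp_sub_one_le_two (x := ((⟪z, x⟫ : ℝ) : ℂ) * Complex.I) (by simp)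
    nlinarith [sq_nonneg ‖z‖]

lemma IsLevyMeasure.integrable_min {m : ℕ} {ν : Measure (Euc m)} (hν : IsLevyMeasure ν) :
    Integrable (fun x : Euc m => min 1 (‖x‖ ^ 2)) ν := by
  refine ⟨Continuous.aestronglyMeasurable (by fun_prop), ?_⟩
  rw [hasFiniteIntegral_iff_ofReal (Eventually.of_forall fun x => by positivity)]
  exact hν.lintegral_lt_top

lemma IsLevyMeasure.integrable_levyIntegrand {m : ℕ} {ν : Measure (Euc m)}
    (hν : IsLevyMeasure ν) (z : Euc m) : Integrable (levyIntegrand z) ν :=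
  (hν.integrable_min.const_mul _).mono' (measurable_levyIntegrand z).aestronglyMeasurable
    (Eventually.of_forall fun x => norm_levyIntegrand_le z x)

/-- First-order integrability near the origin is what makes the uncompensated exponent converge;
outside the unit ball both minima equal `1`. -/
lemma IsLevyMeasure.integrable_min_norm {m : ℕ} {ν : Measure (Euc m)} (hν : IsLevyMeasure ν)
    (h1 : IntegrableOn (fun x : Euc m => x) (Metric.closedBall 0 1) ν) :
    Integrable (fun x : Euc m => min 1 ‖x‖) ν := by
  rw [← integrableOn_univ, ← Set.union_compl_self (Metric.closedBall (0 : Euc m) 1)]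
  refine IntegrableOn.union ?_ ?_
  · refine (integrableOn_congr_fun (fun x hx => ?_) Metric.isClosed_closedBall.measurableSet).1
      h1.norm
    rw [min_eq_right (by simpa using hx)]
  · refine (integrableOn_congr_fun (fun x hx => ?_)
      Metric.isClosed_closedBall.measurableSet.compl).1 hν.integrable_min.integrableOn
    have hx : 1 < ‖x‖ := by simpa using hx
    rw [min_eq_left hx.le, min_eq_left (by nlinarith)]

section ETS
variable {d : ℕ} {α : ℝ} {β : UnitSphere d → ℝ} {lam : Measure (UnitSphere d)}

lemma measurable_smul_sphere :
    Measurable (fun p : UnitSphere d × ℝ => p.2 • (p.1 : Euc d)) :=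
  measurable_snd.smul (measurable_subtype_coe.comp measurable_fst)

lemma measurable_temperedDensity (hβ : Measurable β) :
    Measurable (fun p : UnitSphere d × ℝ => Real.exp (-(β p.1) * p.2) / p.2 ^ (α + 1)) := by
  fun_prop

lemma ae_nonneg_etsLevyMeasure [IsFiniteMeasure lam]
    (hlam : ∀ᵐ w : UnitSphere d ∂lam, ∀ i, 0 ≤ (w : Euc d) i) :
    ∀ᵐ x ∂(etsLevyMeasure α β lam), ∀ i, 0 ≤ x i := by
  unfold etsLevyMeasure
  have hm : MeasurableSet {x : Euc d | ∀ i, 0 ≤ x i} := by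
    rw [Set.ofPred_forall]
    exact MeasurableSet.iInter fun i => measurableSet_le measurable_const (by fun_prop)
  rw [ae_map_iff measurable_smul_sphere.aemeasurable hm]
  refine (withDensity_absolutelyContinuous _ _).ae_le ?_
  have h1 := (Measure.quasiMeasurePreserving_fst (μ := lam)
    (ν := volume.restrict (Set.Ioi (0 : ℝ)))).ae hlam
  have h2 := (Measure.quasiMeasurePreserving_snd (μ := lam)
    (ν := volume.restrict (Set.Ioi (0 : ℝ)))).ae (ae_restrict_mem measurableSet_Ioi)
  filter_upwards [h1, h2] with p hp1 hp2 i
  exact mul_nonneg (le_of_lt hp2) (hp1 i)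

/-- Fubini in polar coordinates. The integrability of the radial integral is recorded because it
becomes the absolute convergence asserted in the theorem. -/
lemma integral_etsLevyMeasure [IsFiniteMeasure lam] (hβ : Measurable β) {f : Euc d → ℂ} (hf : Measurable f)
    (hfi : Integrable f (etsLevyMeasure α β lam)) :
    Integrable (fun w : UnitSphere d => ∫ r in Set.Ioi (0 : ℝ),
      (Real.exp (-(β w) * r) / r ^ (α + 1)) • f (r • (w : Euc d))) lam ∧
    ∫ x, f x ∂(etsLevyMeasure α β lam) = ∫ w : UnitSphere d, (∫ r in Set.Ioi (0 : ℝ),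
      (Real.exp (-(β w) * r) / r ^ (α + 1)) • f (r • (w : Euc d))) ∂lam := by
  unfold etsLevyMeasure at hfi ⊢
  have hd : Measurable (fun p : UnitSphere d × ℝ =>
    ENNReal.ofReal (Real.exp (-(β p.1) * p.2) / p.2 ^ (α + 1))) :=
    (measurable_temperedDensity hβ).ennreal_ofReal
  rw [integrable_map_measure hf.aestronglyMeasurable measurable_smul_sphere.aemeasurable,
    integrable_withDensity_iff_integrable_smul' hd (by simp)] at hfi
  simp only [Function.comp_apply] at hfi
  rw [integral_map measurable_smul_sphere.aemeasurable hf.aestronglyMeasurable,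
    integral_withDensity_eq_integral_toReal_smul hd (by simp), integral_prod _ hfi]
  have e : ∀ w : UnitSphere d, ∫ r in Set.Ioi (0 : ℝ),
      (ENNReal.ofReal (Real.exp (-(β w) * r) / r ^ (α + 1))).toReal • f (r • (w : Euc d))
      = ∫ r in Set.Ioi (0 : ℝ),
      (Real.exp (-(β w) * r) / r ^ (α + 1)) • f (r • (w : Euc d)) := by
    intro w
    refine setIntegral_congr_fun measurableSet_Ioi fun r hr => ?_
    have hr : 0 < r := hr
    beta_reduce
    rw [ENNReal.toReal_ofReal (by positivity)]
  have h := hfi.integral_prod_left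
  simp only [e] at h ⊢
  exact ⟨h, trivial⟩

/-- The Laplace exponent of a driftless exponential tempered stable law, for exponents with
nonpositive real parts. -/
lemma laplaceExponent_ets [IsFiniteMeasure lam] (hα0 : 0 < α) (hα1 : α < 1) (hβ : Measurable β)
    (hβ_pos : ∀ w, 0 < β w) (hlam : ∀ᵐ w : UnitSphere d ∂lam, ∀ i, 0 ≤ (w : Euc d) i)
    (hmin : Integrable (fun x : Euc d => min 1 ‖x‖) (etsLevyMeasure α β lam))
    {u : Fin d → ℂ} (hu : ∀ l, (u l).re ≤ 0) :
    Integrable (fun w : UnitSphere d =>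
      ((β w : ℂ) - pairing u w) ^ (α : ℂ) - ((β w ^ α : ℝ) : ℂ)) lam ∧
    ∫ x, (Complex.exp (pairing u x) - 1) ∂(etsLevyMeasure α β lam)
      = ((Real.Gamma (-α) : ℝ) : ℂ) * ∫ w : UnitSphere d,
        (((β w : ℂ) - pairing u w) ^ (α : ℂ) - ((β w ^ α : ℝ) : ℂ)) ∂lam := by
  have h := integral_etsLevyMeasure (α := α) (lam := lam) hβ (f := fun x => Complex.exp (pairing u x) - 1)
    (by fun_prop) (integrable_exp_pairing_sub_one (ae_nonneg_etsLevyMeasure hlam) hmin hu)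
  have e : (fun w : UnitSphere d => ∫ r in Set.Ioi (0 : ℝ), (Real.exp (-(β w) * r) / r ^ (α + 1)) •
      (Complex.exp (pairing u (r • (w : Euc d))) - 1)) =ᵐ[lam] fun w =>
      ((Real.Gamma (-α) : ℝ) : ℂ) *
        (((β w : ℂ) - pairing u w) ^ (α : ℂ) - ((β w ^ α : ℝ) : ℂ)) := by
    filter_upwards [hlam] with w hw
    simp only [pairing_smul]
    exact integral_exp_sub_one_mul_tempered hα0 hα1 (hβ_pos w) (re_pairing_nonpos hu hw)
  -- Fubini gives integrability only of the product with `Γ(-α)`, so this factor must be divided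
  -- out.
  have hG : ((Real.Gamma (-α) : ℝ) : ℂ) ≠ 0 := by
    refine Complex.ofReal_ne_zero.2 (Real.Gamma_ne_zero fun m hm => ?_)
    rcases m.eq_zero_or_pos with rfl | hm0
    · simp at hm; exact hα0.ne' hm
    · have : (1 : ℝ) ≤ m := by exact_mod_cast hm0
      linarith
  refine ⟨?_, ?_⟩
  · have h2 := (h.1.congr e).const_mul ((Real.Gamma (-α) : ℝ) : ℂ)⁻¹
    simpa only [← mul_assoc, inv_mul_cancel₀ hG, one_mul] using h2
  · rw [h.2, integral_congr_ae e, integral_const_mul]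

end ETS

end SatoSub

namespace SatoSub

/-! ### Linear images of Brownian motions -/

section matVec
variable {n k : ℕ}

lemma matVec_eq (A : Matrix (Fin n) (Fin k) ℝ) (v : Euc k) :
    matVec A v = (Matrix.toEuclideanLin A).toContinuousLinearMap v := rfl

lemma matVec_sub (A : Matrix (Fin n) (Fin k) ℝ) (v w : Euc k) :
    matVec A (v - w) = matVec A v - matVec A w := by simp only [matVec_eq, map_sub]

lemma matVec_add (A : Matrix (Fin n) (Fin k) ℝ) (v w : Euc k) :
    matVec A (v + w) = matVec A v + matVec A w := by simp only [matVec_eq, map_add]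

lemma matVec_smul (A : Matrix (Fin n) (Fin k) ℝ) (c : ℝ) (v : Euc k) :
    matVec A (c • v) = c • matVec A v := by simp only [matVec_eq, map_smul]

lemma matVec_zero (A : Matrix (Fin n) (Fin k) ℝ) : matVec A 0 = 0 := by
  simp only [matVec_eq, map_zero]

@[fun_prop]
lemma continuous_matVec (A : Matrix (Fin n) (Fin k) ℝ) : Continuous (matVec A) :=
  (Matrix.toEuclideanLin A).toContinuousLinearMap.continuous

@[fun_prop]
lemma measurable_matVec (A : Matrix (Fin n) (Fin k) ℝ) : Measurable (matVec A) :=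
  (continuous_matVec A).measurable

lemma inner_matVec (A : Matrix (Fin n) (Fin k) ℝ) (z : Euc n) (v : Euc k) :
    (⟪z, matVec A v⟫ : ℝ) = ⟪matVec Aᵀ z, v⟫ := by
  simp only [matVec, EuclideanSpace.inner_eq_star_dotProduct, star_trivial]
  rw [Matrix.mulVec_transpose, dotProduct_comm, Matrix.dotProduct_mulVec, dotProduct_comm]

/-- The characteristic exponent of `A B(1)` for a Brownian motion `B` with drift `b` and
covariance matrix `C`. -/
noncomputable def brownianExponent (A : Matrix (Fin n) (Fin k) ℝ) (b : Euc k)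
    (C : Matrix (Fin k) (Fin k) ℝ) (z : Euc n) : ℂ :=
  ((⟪matVec Aᵀ z, b⟫ : ℝ) : ℂ) * Complex.I
    - (((matVec Aᵀ z).ofLp ⬝ᵥ C *ᵥ (matVec Aᵀ z).ofLp : ℝ) : ℂ) / 2

variable (A : Matrix (Fin n) (Fin k) ℝ) (b : Euc k) {C : Matrix (Fin k) (Fin k) ℝ}

lemma continuous_brownianExponent : Continuous (brownianExponent A b C) := by
  unfold brownianExponent
  have h : Continuous fun z : Euc n => (matVec Aᵀ z).ofLp :=
    (PiLp.continuous_ofLp 2 _).comp (continuous_matVec Aᵀ)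
  have h2 : Continuous fun z : Euc n => (matVec Aᵀ z).ofLp ⬝ᵥ C *ᵥ (matVec Aᵀ z).ofLp :=
    h.dotProduct (continuous_const.matrix_mulVec h)
  fun_prop

lemma brownianExponent_zero : brownianExponent A b C 0 = 0 := by
  simp [brownianExponent, matVec_zero]

/-- This sign places the exponents in the domain of the extended Laplace transform of `S`. -/
lemma re_brownianExponent_nonpos (hC : C.PosSemidef) (z : Euc n) :
    (brownianExponent A b C z).re ≤ 0 := by
  have h := hC.dotProduct_mulVec_nonneg (matVec Aᵀ z).ofLp
  rw [star_trivial] at h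
  have e : (brownianExponent A b C z).re
      = -((matVec Aᵀ z).ofLp ⬝ᵥ C *ᵥ (matVec Aᵀ z).ofLp) / 2 := by
    unfold brownianExponent
    rw [Complex.sub_re, Complex.re_ofReal_mul, Complex.I_re, mul_zero,
      ← Complex.ofReal_ofNat, ← Complex.ofReal_div, Complex.ofReal_re]
    ring
  rw [e]
  linarith

end matVec

variable {Ω : Type*} [MeasurableSpace Ω] {P : Measure Ω}

section single
variable {n k : ℕ} {B : ℝ≥0 → Ω → Euc k} {b : Euc k} {C : Matrix (Fin k) (Fin k) ℝ}

lemma IsBrownianMotion.integral_exp_increment (hB : IsBrownianMotion B b C P)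
    (A : Matrix (Fin n) (Fin k) ℝ) (z : Euc n) {s t : ℝ≥0} (hst : s ≤ t) :
    ∫ ω, Complex.exp (((⟪z, matVec A (B t ω - B s ω)⟫ : ℝ) : ℂ) * Complex.I) ∂P
      = Complex.exp ((((t : ℝ) - s : ℝ) : ℂ) * brownianExponent A b C z) := by
  have hlaw := hB.hasLaw_increment s t hst
  have hst' : (0 : ℝ) ≤ (t : ℝ) - s := sub_nonneg.2 (by exact_mod_cast hst)
  have h := hlaw.integral_comp
    (f := fun x => Complex.exp (((⟪x, matVec Aᵀ z⟫ : ℝ) : ℂ) * Complex.I))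
    (Continuous.aestronglyMeasurable (by fun_prop))
  rw [← charFun_apply, charFun_multivariateGaussian (hB.posSemidef.smul hst')] at h
  simp_rw [inner_matVec, real_inner_comm _ (matVec Aᵀ z)]
  refine h.trans ?_
  congr 1
  unfold brownianExponent
  rw [real_inner_smul_right, Matrix.smul_mulVec, dotProduct_smul, smul_eq_mul]
  push_cast
  ring

lemma IsBrownianMotion.ae_sub_zero (hB : IsBrownianMotion B b C P) (t : ℝ≥0) :
    ∀ᵐ ω ∂P, B t ω - B 0 ω = B t ω := by
  filter_upwards [hB.start_zero] with ω hω
  rw [hω, sub_zero]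

lemma IsBrownianMotion.integral_exp (hB : IsBrownianMotion B b C P)
    (A : Matrix (Fin n) (Fin k) ℝ) (z : Euc n) (t : ℝ≥0) :
    ∫ ω, Complex.exp (((⟪z, matVec A (B t ω)⟫ : ℝ) : ℂ) * Complex.I) ∂P
      = Complex.exp (((t : ℝ) : ℂ) * brownianExponent A b C z) := by
  have h := hB.integral_exp_increment A z (zero_le (a := t))
  rw [NNReal.coe_zero, sub_zero] at h
  rw [← h]
  refine integral_congr_ae ?_
  filter_upwards [hB.ae_sub_zero t] with ω hω
  rw [hω]

lemma IsBrownianMotion.charFun_matVec (hB : IsBrownianMotion B b C P)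
    (hm : Measurable (B 1)) (A : Matrix (Fin n) (Fin k) ℝ) (z : Euc n) :
    charFun (P.map (fun ω => matVec A (B 1 ω))) z = Complex.exp (brownianExponent A b C z) := by
  have h := hB.integral_exp A z 1
  rw [NNReal.coe_one, Complex.ofReal_one, one_mul] at h
  rw [← h, charFun_apply, integral_map (by fun_prop)
    (Continuous.aestronglyMeasurable (by fun_prop))]
  simp_rw [real_inner_comm z]

/-- A continuous logarithm normalized at the origin is the distinguished logarithm. -/
lemma distinguishedLog_eq {m : ℕ} {f ψ : Euc m → ℂ} (hψ : Continuous ψ) (h0 : ψ 0 = 0)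
    (hf : ∀ z, Complex.exp (ψ z) = f z) : distinguishedLog f = ψ := by
  have hex : ∃ ψ : Euc m → ℂ, Continuous ψ ∧ ψ 0 = 0 ∧ ∀ z, Complex.exp (ψ z) = f z :=
    ⟨ψ, hψ, h0, hf⟩
  unfold distinguishedLog
  rw [dif_pos hex]
  obtain ⟨hc, hc0, hcf⟩ := hex.choose_spec
  set χ := hex.choose
  -- Two continuous logarithms differ by `2πi` times a continuous integer-valued function, which is
  -- constant by connectedness and zero at the origin.
  have hint : ∀ z, ∃ N : ℤ, χ z = ψ z + N * (2 * Real.pi * Complex.I) := fun z =>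
    Complex.exp_eq_exp_iff_exists_int.1 ((hcf z).trans (hf z).symm)
  choose N hN using hint
  have hNc : Continuous (fun z => ((N z : ℤ) : ℝ)) := by
    have e : (fun z => ((N z : ℤ) : ℝ)) = fun z => ((χ z - ψ z) / (2 * Real.pi * Complex.I)).re := by
      funext z
      rw [hN z, add_sub_cancel_left, mul_div_cancel_right₀ _ Complex.two_pi_I_ne_zero,
        Complex.intCast_re]
    rw [e]
    exact Complex.continuous_re.comp ((hc.sub hψ).div_const _)
  have hNc' : Continuous N := Int.isClosedEmbedding_coe_real.isEmbedding.continuous_iff.2 hNc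
  funext z
  have hz : N z = N 0 := PreconnectedSpace.constant (inferInstance) hNc'
  have hN0 : (N 0 : ℂ) * (2 * Real.pi * Complex.I) = 0 := by
    have := hN 0
    rw [hc0, h0, zero_add] at this
    exact this.symm
  rw [hN z, hz, hN0, add_zero]

lemma IsBrownianMotion.distinguishedLog_charFun (hB : IsBrownianMotion B b C P)
    (hm : Measurable (B 1)) (A : Matrix (Fin n) (Fin k) ℝ) :
    distinguishedLog (charFun (P.map (fun ω => matVec A (B 1 ω)))) = brownianExponent A b C :=
  distinguishedLog_eq (continuous_brownianExponent A b) (brownianExponent_zero A b)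
    fun z => (hB.charFun_matVec hm A z).symm

lemma IsBrownianMotion.integral_exp_sum_increments (hB : IsBrownianMotion B b C P)
    (hm : ∀ t, Measurable (B t)) (A : Matrix (Fin n) (Fin k) ℝ) {N : ℕ} (z : Fin N → Euc n)
    {τ : Fin (N + 1) → ℝ≥0} (hτ : Monotone τ) :
    ∫ ω, Complex.exp (((∑ j, ⟪z j, matVec A (B (τ j.succ) ω - B (τ j.castSucc) ω)⟫ : ℝ) : ℂ)
        * Complex.I) ∂P
      = Complex.exp (∑ j, (((τ j.succ : ℝ) - τ j.castSucc : ℝ) : ℂ)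
        * brownianExponent A b C (z j)) := by
  have hind := (hB.indepIncrements N τ hτ).comp
    (fun j v => Complex.exp (((⟪z j, matVec A v⟫ : ℝ) : ℂ) * Complex.I))
    (fun j => by fun_prop)
  have h := hind.integral_fun_prod_eq_prod_integral
    (fun j => Measurable.aestronglyMeasurable (by fun_prop))
  simp only [Function.comp_apply] at h
  simp only [Complex.ofReal_sum, Finset.sum_mul, Complex.exp_sum]
  rw [h]
  refine Finset.prod_congr rfl fun j _ => ?_
  exact hB.integral_exp_increment A (z j) (hτ (Fin.castSucc_le_succ j))

end single

section multi
variable {d n : ℕ} {k : Fin d → ℕ} {B : ∀ l, ℝ≥0 → Ω → Euc (k l)} {b : ∀ l, Euc (k l)}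
  {C : ∀ l, Matrix (Fin (k l)) (Fin (k l)) ℝ}

/-- The exponential is a product over `l` of functionals of the independent paths `B l`.
Coordinatewise monotonicity of `τ` then lets each factor split over the independent increments of a
single Brownian motion. -/
lemma integral_exp_multiparam_increments (hB_meas : ∀ l t, Measurable (B l t))
    (hB : ∀ l, IsBrownianMotion (B l) (b l) (C l) P)
    (hB_indep : iIndepFun (fun l ω (t : ℝ≥0) => B l t ω) P)
    (A : ∀ l, Matrix (Fin n) (Fin (k l)) ℝ) {N : ℕ} (z : Fin N → Euc n)
    {τ : Fin (N + 1) → Fin d → ℝ≥0} (hτ : Monotone τ) :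
    ∫ ω, Complex.exp (((∑ j, ⟪z j, multiparam A B (τ j.succ) ω
        - multiparam A B (τ j.castSucc) ω⟫ : ℝ) : ℂ) * Complex.I) ∂P
      = Complex.exp (∑ j, ∑ l, (((τ j.succ l : ℝ) - τ j.castSucc l : ℝ) : ℂ)
        * brownianExponent (A l) (b l) (C l) (z j)) := by
  let f : ∀ l, (ℝ≥0 → Euc (k l)) → ℂ := fun l v => Complex.exp (((∑ j,
      ⟪z j, matVec (A l) (v (τ j.succ l) - v (τ j.castSucc l))⟫ : ℝ) : ℂ) * Complex.I)
  have hf : ∀ l, Measurable (f l) := by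
    intro l
    have h : ∀ j, Measurable fun v : ℝ≥0 → Euc (k l) =>
        (⟪z j, matVec (A l) (v (τ j.succ l) - v (τ j.castSucc l))⟫ : ℝ) := fun j =>
      Measurable.inner measurable_const ((measurable_matVec _).comp
        ((measurable_pi_apply _).sub (measurable_pi_apply _)))
    exact Complex.measurable_exp.comp ((Complex.measurable_ofReal.comp
      (Finset.measurable_sum Finset.univ fun j _ => h j)).mul_const _)
  have hpath : ∀ l, Measurable (fun ω (t : ℝ≥0) => B l t ω) := fun l =>
    measurable_pi_lambda _ (hB_meas l)
  have h := (hB_indep.comp f hf).integral_fun_prod_eq_prod_integral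
    (fun l => ((hf l).comp (hpath l)).aestronglyMeasurable)
  have e : ∀ ω, Complex.exp (((∑ j, ⟪z j, multiparam A B (τ j.succ) ω
        - multiparam A B (τ j.castSucc) ω⟫ : ℝ) : ℂ) * Complex.I)
      = ∏ l, (f l ∘ fun ω t => B l t ω) ω := by
    intro ω
    simp only [f, Function.comp_apply]
    rw [← Complex.exp_sum, ← Finset.sum_mul, ← Complex.ofReal_sum, Finset.sum_comm]
    simp only [multiparam, ← Finset.sum_sub_distrib, inner_sum, matVec_sub]
  simp_rw [e]
  rw [h, Finset.sum_comm, Complex.exp_sum]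
  refine Finset.prod_congr rfl fun l _ => ?_
  have hτl : Monotone fun i => τ i l := fun i j hij => hτ hij l
  have h1 := (hB l).integral_exp_sum_increments (hB_meas l) (A l) z hτl
  rw [← h1]
  rfl

end multi
end SatoSub

namespace SatoSub

/-! ### Evaluating a process at an independent random parameter -/

section randomParameter
variable {Ω I : Type*} [MeasurableSpace Ω] {P : Measure Ω} [MeasurableSpace I]

lemma measurable_eval_simpleFunc {E : Type*} [MeasurableSpace E] {X : I → Ω → E}
    (hX : ∀ τ, Measurable (X τ)) {T : Ω → I} (hT : Measurable T) (s : SimpleFunc I I) :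
    Measurable (fun ω => X (s (T ω)) ω) := by
  intro u hu
  have e : (fun ω => X (s (T ω)) ω) ⁻¹' u
      = ⋃ c ∈ s.range, (T ⁻¹' (s ⁻¹' {c})) ∩ (X c ⁻¹' u) := by
    ext ω
    simp only [Set.mem_preimage, Set.mem_iUnion, Set.mem_inter_iff, SimpleFunc.mem_range,
      Set.mem_singleton_iff, exists_prop]
    exact ⟨fun h => ⟨_, ⟨_, rfl⟩, rfl, h⟩, fun ⟨c, _, h1, h2⟩ => h1 ▸ h2⟩
  rw [e]
  exact Finset.measurableSet_biUnion _ fun c _ =>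
    (hT (s.measurableSet_preimage {c})).inter (hX c hu)

/-- Only finitely many parameter values `c` occur, and on each event `s (T ω) = c` the indicator is
independent of `Φ c`, so the mean factors term by term. -/
lemma integral_eval_simpleFunc [IsProbabilityMeasure P] {Φ : I → Ω → ℂ}
    (hΦ : ∀ τ, Measurable (Φ τ)) {K : ℝ} (hK : ∀ τ ω, ‖Φ τ ω‖ ≤ K) {T : Ω → I}
    (hT : Measurable T) (hind : ∀ τ, IndepFun T (Φ τ) P) (s : SimpleFunc I I) :
    ∫ ω, Φ (s (T ω)) ω ∂P = ∫ ω, (∫ ω', Φ (s (T ω)) ω' ∂P) ∂P := by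
  classical
  let χ : I → I → ℂ := fun c => (s ⁻¹' {c}).indicator fun _ => 1
  have hχ : ∀ c, Measurable (χ c) := fun c =>
    measurable_const.indicator (s.measurableSet_preimage {c})
  have hχ1 : ∀ c τ, ‖χ c τ‖ ≤ 1 := by
    intro c τ
    simp only [χ]
    exact (norm_indicator_le_norm_self _ _).trans (by simp)
  have hdec : ∀ (F : I → ℂ) τ, F (s τ) = ∑ c ∈ s.range, χ c τ * F c := by
    intro F τ
    rw [Finset.sum_eq_single (s τ)]
    · simp [χ]
    · intro c _ hc
      simp [χ, hc.symm]
    · intro h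
      exact absurd (s.mem_range_self τ) h
  have hint : ∀ c, Integrable (fun ω => χ c (T ω) * Φ c ω) P := by
    intro c
    refine Integrable.of_bound (C := K) ((((hχ c).comp hT).mul (hΦ c)).aestronglyMeasurable) ?_
    refine Eventually.of_forall fun ω => ?_
    rw [norm_mul]
    calc _ ≤ 1 * ‖Φ c ω‖ := by gcongr; exact hχ1 _ _
      _ ≤ K := by rw [one_mul]; exact hK c ω
  have hint2 : ∀ c, Integrable (fun ω => χ c (T ω) * ∫ ω', Φ c ω' ∂P) P := by
    intro c
    refine Integrable.mul_const ?_ _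
    exact Integrable.of_bound (C := 1) ((hχ c).comp hT).aestronglyMeasurable
      (Eventually.of_forall fun ω => hχ1 _ _)
  have e1 : ∀ ω, Φ (s (T ω)) ω = ∑ c ∈ s.range, χ c (T ω) * Φ c ω :=
    fun ω => hdec (fun c => Φ c ω) (T ω)
  have e2 : ∀ ω, (∫ ω', Φ (s (T ω)) ω' ∂P) = ∑ c ∈ s.range, χ c (T ω) * ∫ ω', Φ c ω' ∂P :=
    fun ω => hdec (fun c => ∫ ω', Φ c ω' ∂P) (T ω)
  simp_rw [e2]
  simp_rw [e1]
  rw [integral_finsetSum _ fun c _ => hint c, integral_finsetSum _ fun c _ => hint2 c]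
  refine Finset.sum_congr rfl fun c _ => ?_
  rw [integral_mul_const]
  exact ((hind c).comp (hχ c) measurable_id).integral_fun_mul_eq_mul_integral
    ((hχ c).comp hT).aestronglyMeasurable (hΦ c).aestronglyMeasurable

variable [PseudoEMetricSpace I] [OpensMeasurableSpace I] [TopologicalSpace.SeparableSpace I]

lemma exists_simpleFunc_tendsto_id [Nonempty I] :
    ∃ s : ℕ → SimpleFunc I I, ∀ τ, Tendsto (fun N => s N τ) atTop (𝓝 τ) := by
  obtain ⟨y⟩ := ‹Nonempty I›
  refine ⟨SimpleFunc.approxOn id measurable_id Set.univ y trivial, fun τ => ?_⟩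
  exact SimpleFunc.tendsto_approxOn measurable_id _ (by simp)

/-- Joint measurability of `X` is replaced by path continuity: `X` at `T` is a limit of evaluations
at simple approximations of `T`. Continuity holds only almost surely, hence `AEMeasurable`. -/
lemma aemeasurable_eval_random {E : Type*} [MeasurableSpace E] [TopologicalSpace E]
    [TopologicalSpace.PseudoMetrizableSpace E] [BorelSpace E] {X : I → Ω → E}
    (hX : ∀ τ, Measurable (X τ)) (hc : ∀ᵐ ω ∂P, Continuous fun τ => X τ ω) {T : Ω → I}
    (hT : Measurable T) : AEMeasurable (fun ω => X (T ω) ω) P := by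
  cases isEmpty_or_nonempty I
  · have : IsEmpty Ω := Function.isEmpty T
    exact (measurable_of_empty _).aemeasurable
  obtain ⟨s, hs⟩ := exists_simpleFunc_tendsto_id (I := I)
  refine aemeasurable_of_tendsto_metrizable_ae atTop
    (fun N => (measurable_eval_simpleFunc hX hT (s N)).aemeasurable) ?_
  filter_upwards [hc] with ω hω
  exact (hω.tendsto _).comp (hs (T ω))

/-- The mean of a bounded continuous process at an independent random parameter is obtained by
averaging first over the process and then over the parameter. -/
lemma integral_eval_random [IsProbabilityMeasure P] {Φ : I → Ω → ℂ}
    (hΦ : ∀ τ, Measurable (Φ τ)) {K : ℝ} (hK : ∀ τ ω, ‖Φ τ ω‖ ≤ K)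
    (hc : ∀ᵐ ω ∂P, Continuous fun τ => Φ τ ω) {T : Ω → I}
    (hT : Measurable T) (hind : ∀ τ, IndepFun T (Φ τ) P) :
    ∫ ω, Φ (T ω) ω ∂P = ∫ ω, (∫ ω', Φ (T ω) ω' ∂P) ∂P := by
  obtain ⟨ω₀⟩ : Nonempty Ω := nonempty_of_isProbabilityMeasure P
  have : Nonempty I := ⟨T ω₀⟩
  -- The identity for simple parameters passes to the limit on both sides by dominated convergence.
  obtain ⟨s, hs⟩ := exists_simpleFunc_tendsto_id (I := I)
  have hK0 : ∀ τ, ‖∫ ω', Φ τ ω' ∂P‖ ≤ K := fun τ =>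
    (norm_integral_le_of_norm_le_const (Eventually.of_forall (hK τ))).trans (by simp)
  have hmean : ∀ τ, Tendsto (fun N => ∫ ω', Φ (s N τ) ω' ∂P) atTop (𝓝 (∫ ω', Φ τ ω' ∂P)) := by
    intro τ
    refine tendsto_integral_of_dominated_convergence (fun _ => K)
      (fun N => (hΦ _).aestronglyMeasurable) (integrable_const _)
      (fun N => Eventually.of_forall fun ω => hK _ _) ?_
    filter_upwards [hc] with ω hω
    exact (hω.tendsto _).comp (hs τ)
  have h1 : Tendsto (fun N => ∫ ω, Φ (s N (T ω)) ω ∂P) atTop (𝓝 (∫ ω, Φ (T ω) ω ∂P)) := by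
    refine tendsto_integral_of_dominated_convergence (fun _ => K)
      (fun N => (measurable_eval_simpleFunc hΦ hT (s N)).aestronglyMeasurable)
      (integrable_const _) (fun N => Eventually.of_forall fun ω => hK _ _) ?_
    filter_upwards [hc] with ω hω
    exact (hω.tendsto _).comp (hs (T ω))
  have h2 : Tendsto (fun N => ∫ ω, (∫ ω', Φ (s N (T ω)) ω' ∂P) ∂P) atTop
      (𝓝 (∫ ω, (∫ ω', Φ (T ω) ω' ∂P) ∂P)) := by
    refine tendsto_integral_of_dominated_convergence (fun _ => K)
      (fun N => ?_) (integrable_const _) (fun N => Eventually.of_forall fun ω => hK0 _)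
      (Eventually.of_forall fun ω => hmean _)
    exact (((s N).map fun τ => ∫ ω', Φ τ ω' ∂P).measurable.comp hT).aestronglyMeasurable
  refine tendsto_nhds_unique h1 (h2.congr fun N => ?_)
  exact (integral_eval_simpleFunc hΦ hK hT hind (s N)).symm

end randomParameter
end SatoSub

namespace SatoSub

/-! ### Multiparameter subordination -/

/-- A multiparameter Brownian motion `multiparam A B` and an independent process `S` with
increasing paths in the nonnegative orthant. -/
structure IsSubordination {Ω : Type*} [MeasurableSpace Ω] (P : Measure Ω) {d n : ℕ}
    {k : Fin d → ℕ} (S : ℝ≥0 → Ω → Euc d) (b : ∀ l, Euc (k l))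
    (C : ∀ l, Matrix (Fin (k l)) (Fin (k l)) ℝ) (B : ∀ l, ℝ≥0 → Ω → Euc (k l))
    (A : ∀ l, Matrix (Fin n) (Fin (k l)) ℝ) : Prop where
  measurable_param : ∀ t, Measurable (S t)
  nonneg : ∀ᵐ ω ∂P, ∀ t i, 0 ≤ S t ω i
  monotone : ∀ᵐ ω ∂P, ∀ i, Monotone (fun t => S t ω i)
  measurable_brownian : ∀ l t, Measurable (B l t)
  brownian : ∀ l, IsBrownianMotion (B l) (b l) (C l) P
  indep_brownian : iIndepFun (fun l ω (t : ℝ≥0) => B l t ω) P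
  indep : IndepFun (fun ω (t : ℝ≥0) => S t ω)
    (fun ω (s : Fin d → ℝ≥0) => multiparam A B s ω) P

variable {Ω : Type*} [MeasurableSpace Ω] {P : Measure Ω} {d n : ℕ}
    {k : Fin d → ℕ} {S : ℝ≥0 → Ω → Euc d} {b : ∀ l, Euc (k l)}
    {C : ∀ l, Matrix (Fin (k l)) (Fin (k l)) ℝ} {B : ∀ l, ℝ≥0 → Ω → Euc (k l)}
    {A : ∀ l, Matrix (Fin n) (Fin (k l)) ℝ}

/-- The vector of the characteristic exponents of `A l B l (1)`. -/
noncomputable def exponents (A : ∀ l, Matrix (Fin n) (Fin (k l)) ℝ) (b : ∀ l, Euc (k l))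
    (C : ∀ l, Matrix (Fin (k l)) (Fin (k l)) ℝ) (z : Euc n) (l : Fin d) : ℂ :=
  brownianExponent (A l) (b l) (C l) z

lemma measurable_multiparam (hB : ∀ l t, Measurable (B l t)) (s : Fin d → ℝ≥0) :
    Measurable (multiparam A B s) := by
  unfold multiparam
  exact Finset.measurable_sum _ fun l _ => (measurable_matVec _).comp (hB l _)

omit [MeasurableSpace Ω] in
lemma continuous_multiparam {ω : Ω} (h : ∀ l, Continuous fun t => B l t ω) :
    Continuous fun s => multiparam A B s ω := by
  unfold multiparam
  exact continuous_finsetSum _ fun l _ =>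
    (continuous_matVec _).comp ((h l).comp (continuous_apply l))

/-- The sum `∑ j, ⟪z j, v (τ (j + 1)) - v (τ j)⟫` over the increments of `v`. -/
noncomputable def incrementSum {I : Type*} {N : ℕ} (z : Fin N → Euc n) (τ : Fin (N + 1) → I)
    (v : I → Euc n) : ℝ :=
  ∑ j, ⟪z j, v (τ j.succ) - v (τ j.castSucc)⟫

lemma measurable_incrementSum {I : Type*} {N : ℕ} (z : Fin N → Euc n) (τ : Fin (N + 1) → I) :
    Measurable (incrementSum z τ) := by
  unfold incrementSum
  refine Finset.measurable_sum _ fun j _ => Measurable.inner measurable_const ?_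
  have h1 : Measurable fun v : I → Euc n => v (τ j.succ) := measurable_pi_apply _
  have h2 : Measurable fun v : I → Euc n => v (τ j.castSucc) := measurable_pi_apply _
  exact h1.sub h2

lemma continuous_incrementSum {I : Type*} [TopologicalSpace I] {N : ℕ} (z : Fin N → Euc n)
    {v : I → Euc n} (hv : Continuous v) :
    Continuous fun τ : Fin (N + 1) → I => incrementSum z τ v := by
  unfold incrementSum
  refine continuous_finsetSum _ fun j _ => Continuous.inner continuous_const ?_
  exact (hv.comp (continuous_apply j.succ)).sub (hv.comp (continuous_apply j.castSucc))

namespace IsSubordination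

lemma re_exponents_nonpos (h : IsSubordination P S b C B A) (z : Euc n) (l : Fin d) :
    (exponents A b C z l).re ≤ 0 :=
  re_brownianExponent_nonpos _ _ (h.brownian l).posSemidef z

lemma ae_continuous (h : IsSubordination P S b C B A) :
    ∀ᵐ ω ∂P, Continuous fun s => multiparam A B s ω := by
  filter_upwards [ae_all_iff.2 fun l => (h.brownian l).continuous_paths] with ω hω
  exact continuous_multiparam hω

/-- The random parameter vector at a finite number of times. -/
lemma measurable_times (h : IsSubordination P S b C B A) {N : ℕ} (t : Fin N → ℝ≥0) :
    Measurable fun ω (j : Fin N) (l : Fin d) => (S (t j) ω l).toNNReal := by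
  refine measurable_pi_lambda _ fun j => measurable_pi_lambda _ fun l => ?_
  have := h.measurable_param (t j)
  fun_prop

lemma aemeasurable_subordinated (h : IsSubordination P S b C B A) (t : ℝ≥0) :
    AEMeasurable (subordinated (multiparam A B) S t) P := by
  have hT : Measurable fun ω (l : Fin d) => (S t ω l).toNNReal := by
    refine measurable_pi_lambda _ fun l => ?_
    have := h.measurable_param t
    fun_prop
  exact aemeasurable_eval_random (measurable_multiparam h.measurable_brownian) h.ae_continuous hT

/-- With the path of `S` frozen, its values at the ordered times form an increasing chain of
parameters, so the Brownian formula applies. All increments are treated jointly because independence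
is deduced from this identity. -/
lemma integral_exp_increments [IsProbabilityMeasure P] (h : IsSubordination P S b C B A)
    {N : ℕ} {t : Fin (N + 1) → ℝ≥0} (ht : Monotone t) (z : Fin N → Euc n) :
    ∫ ω, Complex.exp (((∑ j, ⟪z j, subordinated (multiparam A B) S (t j.succ) ω
        - subordinated (multiparam A B) S (t j.castSucc) ω⟫ : ℝ) : ℂ) * Complex.I) ∂P
      = ∫ ω, Complex.exp (∑ j, pairing (exponents A b C (z j))
        (S (t j.succ) ω - S (t j.castSucc) ω)) ∂P := by
  let T : Ω → Fin (N + 1) → Fin d → ℝ≥0 := fun ω j l => (S (t j) ω l).toNNReal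
  let g : (Fin (N + 1) → Fin d → ℝ≥0) → ((Fin d → ℝ≥0) → Euc n) → ℂ := fun τ v =>
    Complex.exp ((incrementSum z τ v : ℂ) * Complex.I)
  have hg : ∀ τ, Measurable (g τ) := by
    intro τ
    have := measurable_incrementSum z τ
    fun_prop
  have hpath : Measurable fun ω (s : Fin d → ℝ≥0) => multiparam A B s ω :=
    measurable_pi_lambda _ fun s => measurable_multiparam h.measurable_brownian s
  have hTS : ∀ τ, IndepFun T (fun ω => g τ fun s => multiparam A B s ω) P := by
    intro τ
    have hφ : Measurable fun (v : ℝ≥0 → Euc d) (j : Fin (N + 1)) (l : Fin d) =>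
        (v (t j) l).toNNReal := by
      refine measurable_pi_lambda _ fun j => measurable_pi_lambda _ fun l => ?_
      have h1 : Measurable fun v : ℝ≥0 → Euc d => v (t j) := measurable_pi_apply _
      fun_prop
    exact h.indep.comp hφ (hg τ)
  have key := integral_eval_random (P := P) (Φ := fun τ ω => g τ fun s => multiparam A B s ω)
    (fun τ => (hg τ).comp hpath) (K := 1)
    (fun τ ω => by simp only [g]; rw [Complex.norm_exp_ofReal_mul_I]) ?_
    (h.measurable_times t) hTS
  · refine Eq.trans ?_ (key.trans ?_)
    · rfl
    · refine integral_congr_ae ?_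
      filter_upwards [h.nonneg, h.monotone] with ω h0 hm
      have hmono : Monotone (T ω) := fun i j hij l => Real.toNNReal_le_toNNReal (hm l (ht hij))
      refine (integral_exp_multiparam_increments h.measurable_brownian h.brownian
        h.indep_brownian A z hmono).trans ?_
      congr 1
      refine Finset.sum_congr rfl fun j _ => Finset.sum_congr rfl fun l _ => ?_
      simp only [T, Real.coe_toNNReal _ (h0 _ _), exponents, PiLp.sub_apply]
      rw [mul_comm]
  · filter_upwards [h.ae_continuous] with ω hω
    simp only [g]
    have := continuous_incrementSum z hω
    fun_prop

lemma integral_exp_increment [IsProbabilityMeasure P] (h : IsSubordination P S b C B A)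
    {s t : ℝ≥0} (hst : s ≤ t) (z : Euc n) :
    ∫ ω, Complex.exp (((⟪z, subordinated (multiparam A B) S t ω
        - subordinated (multiparam A B) S s ω⟫ : ℝ) : ℂ) * Complex.I) ∂P
      = ∫ ω, Complex.exp (pairing (exponents A b C z) (S t ω - S s ω)) ∂P := by
  have := h.integral_exp_increments (N := 1) (t := ![s, t])
    (by intro i j hij; fin_cases i <;> fin_cases j <;> simp_all) (fun _ => z)
  simpa using this

/-- The joint characteristic function of the increments of `Y` is the mean of a product of functions
of single increments of `S`, which are independent; the factors are the marginal characteristic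
functions. -/
lemma hasIndepIncrements_subordinated [IsProbabilityMeasure P]
    (h : IsSubordination P S b C B A) (hS : HasIndepIncrements S P) :
    HasIndepIncrements (subordinated (multiparam A B) S) P := by
  intro N t ht
  have hY := h.aemeasurable_subordinated
  have hYi : ∀ j : Fin N, AEMeasurable (fun ω => subordinated (multiparam A B) S (t j.succ) ω
      - subordinated (multiparam A B) S (t j.castSucc) ω) P := fun j => (hY _).sub (hY _)
  rw [iIndepFun_iff_charFun_pi hYi]
  intro z
  have hinc : AEMeasurable (fun ω => WithLp.toLp 2 fun j : Fin N =>
      subordinated (multiparam A B) S (t j.succ) ω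
        - subordinated (multiparam A B) S (t j.castSucc) ω) P := by
    refine (WithLp.measurable_toLp 2 _).comp_aemeasurable ?_
    exact aemeasurable_pi_lambda _ hYi
  rw [charFun_apply, integral_map hinc (Continuous.aestronglyMeasurable (by fun_prop))]
  have e : ∀ ω, Complex.exp (((⟪WithLp.toLp 2 fun j : Fin N =>
      subordinated (multiparam A B) S (t j.succ) ω
        - subordinated (multiparam A B) S (t j.castSucc) ω, z⟫ : ℝ) : ℂ) * Complex.I)
      = Complex.exp (((∑ j, ⟪z j, subordinated (multiparam A B) S (t j.succ) ω
        - subordinated (multiparam A B) S (t j.castSucc) ω⟫ : ℝ) : ℂ) * Complex.I) := by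
    intro ω
    rw [PiLp.inner_apply]
    simp_rw [real_inner_comm (z _)]
  simp_rw [e]
  rw [h.integral_exp_increments ht (fun j => z j)]
  have hind := ((hS N t ht).comp (fun j v => Complex.exp (pairing (exponents A b C (z j)) v))
    (fun j => by fun_prop)).integral_fun_prod_eq_prod_integral (fun j => by
      have := h.measurable_param
      exact Measurable.aestronglyMeasurable (by fun_prop))
  simp only [Function.comp_apply] at hind
  simp_rw [Complex.exp_sum]
  rw [hind]
  refine Finset.prod_congr rfl fun j _ => ?_
  rw [charFun_apply, integral_map (hYi j)
    (Continuous.aestronglyMeasurable (by fun_prop))]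
  simp_rw [real_inner_comm (z j)]
  exact (h.integral_exp_increment (ht (Fin.castSucc_le_succ j)) (z j)).symm

lemma ae_subordinated_zero (h : IsSubordination P S b C B A) (hS : ∀ᵐ ω ∂P, S 0 ω = 0) :
    ∀ᵐ ω ∂P, subordinated (multiparam A B) S 0 ω = 0 := by
  filter_upwards [hS, ae_all_iff.2 fun l => (h.brownian l).start_zero] with ω h1 h2
  simp [subordinated, multiparam, h1, h2, matVec_zero]

lemma charFun_subordinated [IsProbabilityMeasure P] (h : IsSubordination P S b C B A)
    (hS : ∀ᵐ ω ∂P, S 0 ω = 0) (t : ℝ≥0) (z : Euc n) :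
    charFun (P.map (subordinated (multiparam A B) S t)) z
      = ∫ ω, Complex.exp (pairing (exponents A b C z) (S t ω)) ∂P := by
  have h1 := h.integral_exp_increment (zero_le (a := t)) z
  rw [charFun_apply, integral_map (h.aemeasurable_subordinated t)
    (Continuous.aestronglyMeasurable (by fun_prop))]
  simp_rw [real_inner_comm z]
  refine Eq.trans ?_ (h1.trans ?_)
  · refine integral_congr_ae ?_
    filter_upwards [h.ae_subordinated_zero hS] with ω hω
    rw [hω, sub_zero]
  · refine integral_congr_ae ?_
    filter_upwards [hS] with ω hω
    rw [hω, sub_zero]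

omit [MeasurableSpace Ω] in
lemma tendsto_subordinated {ι : Type*} {u : Filter ι} {f : ι → ℝ≥0} {x : Euc d} {ω : Ω}
    (hω : Continuous fun s => multiparam A B s ω) (hf : Tendsto (fun i => S (f i) ω) u (𝓝 x)) :
    Tendsto (fun i => subordinated (multiparam A B) S (f i) ω) u
      (𝓝 (multiparam A B (fun l => (x l).toNNReal) ω)) := by
  have hc : Continuous fun (x : Euc d) (l : Fin d) => (x l).toNNReal := by
    refine continuous_pi fun l => ?_
    fun_prop
  exact ((hω.comp hc).tendsto x).comp hf

/-- Convergence in measure amounts to almost sure convergence along a further subsequence of every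
subsequence, and almost sure convergence survives composition with the continuous paths of `B_A`. -/
lemma tendstoInMeasure_subordinated [IsProbabilityMeasure P] (h : IsSubordination P S b C B A)
    {t : ℝ≥0} (hS : TendstoInMeasure P S (𝓝 t) (S t)) :
    TendstoInMeasure P (subordinated (multiparam A B) S) (𝓝 t)
      (subordinated (multiparam A B) S t) := by
  intro ε hε
  refine tendsto_of_seq_tendsto fun x hx => ?_
  have hseq : TendstoInMeasure P (fun i => subordinated (multiparam A B) S (x i)) atTop
      (subordinated (multiparam A B) S t) := by
    rw [exists_seq_tendstoInMeasure_atTop_iff fun i =>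
      (h.aemeasurable_subordinated (x i)).aestronglyMeasurable]
    intro ns hns
    have h1 : TendstoInMeasure P (fun i => S (x (ns i))) atTop (S t) :=
      hS.comp (hx.comp hns.tendsto_atTop)
    obtain ⟨ns', hns', hae⟩ := h1.exists_seq_tendsto_ae
    refine ⟨ns', hns', ?_⟩
    filter_upwards [hae, h.ae_continuous] with ω h2 h3
    exact tendsto_subordinated (f := fun i => x (ns (ns' i))) h3 h2
  exact hseq ε hε

lemma isAdditiveProcess_subordinated [IsProbabilityMeasure P] (h : IsSubordination P S b C B A)
    (hS : IsAdditiveProcess S P) : IsAdditiveProcess (subordinated (multiparam A B) S) P where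
  aemeasurable := h.aemeasurable_subordinated
  start_zero := h.ae_subordinated_zero hS.start_zero
  indepIncrements := h.hasIndepIncrements_subordinated hS.indepIncrements
  stochContinuous t := h.tendstoInMeasure_subordinated (hS.stochContinuous t)
  cadlag := by
    filter_upwards [hS.cadlag, h.ae_continuous] with ω h1 h2 t
    obtain ⟨hr, l, hl⟩ := h1 t
    exact ⟨tendsto_subordinated (f := fun s => s) h2 hr, _,
      tendsto_subordinated (f := fun s => s) h2 hl⟩

end IsSubordination
end SatoSub

namespace SatoSub

/-! ### Mixtures of laws along a Lévy measure -/

section mixture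
variable {X Ω : Type*} [MeasurableSpace X] [MeasurableSpace Ω] {ν : Measure X} {P : Measure Ω}
  {n : ℕ} {W : X × Ω → Euc n}

/-- The truncation of a vector to the closed unit ball. -/
noncomputable def truncate (y : Euc n) : Euc n :=
  (Metric.closedBall (0 : Euc n) 1).indicator (fun x => x) y

lemma measurable_truncate : Measurable (truncate (n := n)) :=
  Measurable.indicator measurable_id Metric.isClosed_closedBall.measurableSet

lemma norm_truncate_le (y : Euc n) : ‖truncate y‖ ≤ 1 := by
  unfold truncate
  by_cases h : y ∈ Metric.closedBall (0 : Euc n) 1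
  · rw [Set.indicator_of_mem h]; simpa using h
  · rw [Set.indicator_of_notMem h, norm_zero]; exact zero_le_one

lemma levyIntegrand_eq (z y : Euc n) :
    levyIntegrand z y = Complex.exp (((⟪z, y⟫ : ℝ) : ℂ) * Complex.I) - 1
      - ((⟪z, truncate y⟫ : ℝ) : ℂ) * Complex.I := by
  unfold levyIntegrand truncate
  by_cases h : y ∈ Metric.closedBall (0 : Euc n) 1
  · rw [Set.indicator_of_mem h, Set.indicator_of_mem h]
  · rw [Set.indicator_of_notMem h, Set.indicator_of_notMem h, inner_zero_right]
    simp

lemma levyIntegrand_zero (z : Euc n) : levyIntegrand z 0 = 0 := by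
  simp [levyIntegrand]

lemma integrable_restrict_compl_zero {E F : Type*} [MeasurableSpace E] [Zero E]
    [MeasurableSingletonClass E] [NormedAddCommGroup F] {κ : Measure E} {f : E → F}
    (hf : f 0 = 0) : Integrable f (κ.restrict {0}ᶜ) ↔ Integrable f κ := by
  refine integrableOn_iff_integrable_of_support_subset fun x hx => ?_
  rintro rfl
  exact hx hf

lemma integral_restrict_compl_zero {E F : Type*} [MeasurableSpace E] [Zero E]
    [MeasurableSingletonClass E] [NormedAddCommGroup F] [NormedSpace ℝ F] {κ : Measure E}
    {f : E → F} (hf : f 0 = 0) : ∫ x, f x ∂(κ.restrict {0}ᶜ) = ∫ x, f x ∂κ := by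
  refine setIntegral_eq_integral_of_forall_compl_eq_zero fun x hx => ?_
  rw [Set.mem_compl_iff, not_not, Set.mem_singleton_iff] at hx
  rw [hx, hf]

/-- The compound of a family of laws, given by random vectors `W (x, ·)`, along a measure `ν`
is infinitely divisible without Gaussian part and without drift. -/
lemma exists_hasLevyTriplet_mixture [SFinite ν] [IsProbabilityMeasure P] (hW : Measurable W)
    (hmin : Integrable (fun p => min 1 (‖W p‖ ^ 2)) (ν.prod P))
    (hφ : ∀ z : Euc n, Integrable (fun x =>
      ∫ ω, (Complex.exp (((⟪z, W (x, ω)⟫ : ℝ) : ℂ) * Complex.I) - 1) ∂P) ν)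
    {μ : Measure (Euc n)} (hμ : ∀ z, charFun μ z = Complex.exp (∫ x,
      (∫ ω, (Complex.exp (((⟪z, W (x, ω)⟫ : ℝ) : ℂ) * Complex.I) - 1) ∂P) ∂ν)) :
    ∃ (νY : Measure (Euc n)) (γ : Euc n), HasLevyTriplet μ 0 νY γ ∧
      (IntegrableOn (fun x : Euc n => x) (Metric.closedBall 0 1) νY →
        γ = ∫ x in Metric.closedBall (0 : Euc n) 1, x ∂νY) := by
  let κ : Measure (Euc n) := (ν.prod P).map W
  -- `W` may vanish with positive probability, so the mass at the origin is removed; every integrand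
  -- below is zero there.
  let νY : Measure (Euc n) := κ.restrict {0}ᶜ
  -- Averaging over `ω` first can produce cancellation: `G` is `ν`-integrable even if the truncated
  -- jumps are not integrable for the product measure.
  let G : X → Euc n := fun x => ∫ ω, truncate (W (x, ω)) ∂P
  have hWx : ∀ x, Measurable fun ω => W (x, ω) := fun x => hW.comp measurable_prodMk_left
  have hL : IsLevyMeasure νY := by
    constructor
    · simp [νY]
    · have h1 : Integrable (fun x : Euc n => min 1 (‖x‖ ^ 2)) νY := by
        rw [integrable_restrict_compl_zero (by simp), integrable_map_measure
          (Continuous.aestronglyMeasurable (by fun_prop)) hW.aemeasurable]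
        exact hmin
      have h2 := h1.2
      rwa [hasFiniteIntegral_iff_ofReal (Eventually.of_forall fun x => by positivity)] at h2
  have hlevy : ∀ z, Integrable (fun p => levyIntegrand z (W p)) (ν.prod P) := by
    intro z
    have h := hL.integrable_levyIntegrand z
    rw [integrable_restrict_compl_zero (levyIntegrand_zero z), integrable_map_measure
      (measurable_levyIntegrand z).aestronglyMeasurable hW.aemeasurable] at h
    exact h
  have htr : ∀ x, Integrable (fun ω => truncate (W (x, ω))) P := fun x =>
    Integrable.of_bound (C := 1) (measurable_truncate.comp (hWx x)).aestronglyMeasurable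
      (Eventually.of_forall fun ω => norm_truncate_le _)
  have hG : ∀ (z : Euc n) x, ((⟪z, G x⟫ : ℝ) : ℂ) * Complex.I
      = (∫ ω, (Complex.exp (((⟪z, W (x, ω)⟫ : ℝ) : ℂ) * Complex.I) - 1) ∂P)
        - ∫ ω, levyIntegrand z (W (x, ω)) ∂P := by
    intro z x
    have hexp : Integrable (fun ω => Complex.exp (((⟪z, W (x, ω)⟫ : ℝ) : ℂ) * Complex.I) - 1) P := by
      refine Integrable.of_bound (C := 2) ?_
        (Eventually.of_forall fun ω => norm_exp_sub_one_le_two (by simp))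
      have := hWx x
      exact Measurable.aestronglyMeasurable (by fun_prop)
    have hin : Integrable (fun ω => ((⟪z, truncate (W (x, ω))⟫ : ℝ) : ℂ) * Complex.I) P :=
      (((htr x).const_inner z).ofReal (𝕜 := ℂ)).mul_const _
    simp_rw [levyIntegrand_eq]
    rw [integral_sub hexp hin, sub_sub_cancel, integral_mul_const, integral_complex_ofReal,
      integral_inner (htr x)]
  -- By `hG`, `i⟨z, G⟩` is the difference of the uncompensated and the compensated means, both
  -- `ν`-integrable.
  have hGi : ∀ z : Euc n, Integrable (fun x => (⟪z, G x⟫ : ℝ)) ν := by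
    intro z
    have h1 : Integrable (fun x => ((⟪z, G x⟫ : ℝ) : ℂ) * Complex.I) ν := by
      simp_rw [hG]
      exact (hφ z).sub (hlevy z).integral_prod_left
    have h2 := h1.im
    simpa using h2
  have hGint : Integrable G ν := by
    have h1 : Integrable (fun x => ∑ i, (⟪EuclideanSpace.basisFun (Fin n) ℝ i, G x⟫ : ℝ)
        • EuclideanSpace.basisFun (Fin n) ℝ i) ν :=
      integrable_finsetSum _ fun i _ => (hGi _).smul_const _
    simpa only [OrthonormalBasis.sum_repr'] using h1
  refine ⟨νY, ∫ x, G x ∂ν, ⟨Matrix.PosSemidef.zero, hL, fun z => ?_⟩, fun h => ?_⟩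
  · rw [hμ z]
    congr 1
    have e1 : ∫ y, levyIntegrand z y ∂νY = ∫ x, (∫ ω, levyIntegrand z (W (x, ω)) ∂P) ∂ν := by
      rw [integral_restrict_compl_zero (levyIntegrand_zero z), integral_map hW.aemeasurable
        (measurable_levyIntegrand z).aestronglyMeasurable, integral_prod _ (hlevy z)]
    have e2 : ((⟪∫ x, G x ∂ν, z⟫ : ℝ) : ℂ) * Complex.I
        = ∫ x, ((⟪z, G x⟫ : ℝ) : ℂ) * Complex.I ∂ν := by
      rw [integral_mul_const, integral_complex_ofReal, integral_inner hGint, real_inner_comm]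
    rw [e1, e2, Matrix.zero_mulVec, dotProduct_zero, mul_zero, Complex.ofReal_zero, sub_zero]
    simp_rw [hG]
    rw [integral_sub (hφ z) (hlevy z).integral_prod_left, sub_add_cancel]
  -- If the small jumps are absolutely integrable, Fubini identifies the iterated integral with the
  -- integral against `νY`.
  · have hb : MeasurableSet (Metric.closedBall (0 : Euc n) 1) :=
      Metric.isClosed_closedBall.measurableSet
    have h0 : truncate (0 : Euc n) = 0 := by simp [truncate]
    have h1 : Integrable (truncate (n := n)) νY := (integrable_indicator_iff hb).2 h
    rw [integrable_restrict_compl_zero h0, integrable_map_measure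
      measurable_truncate.aestronglyMeasurable hW.aemeasurable] at h1
    rw [← integral_indicator hb]
    change _ = ∫ y, truncate y ∂νY
    rw [integral_restrict_compl_zero h0, integral_map hW.aemeasurable
      measurable_truncate.aestronglyMeasurable]
    exact (integral_prod _ h1).symm

end mixture
end SatoSub

namespace SatoSub

/-! ### Gaussian families with the marginal laws of a multiparameter Brownian motion -/

section gaussianFamily
variable {Ω : Type*} [MeasurableSpace Ω] {P : Measure Ω} {d n : ℕ}
    {k : Fin d → ℕ} {S : ℝ≥0 → Ω → Euc d} {b : ∀ l, Euc (k l)}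
    {C : ∀ l, Matrix (Fin (k l)) (Fin (k l)) ℝ} {B : ∀ l, ℝ≥0 → Ω → Euc (k l)}
    {A : ∀ l, Matrix (Fin n) (Fin (k l)) ℝ}

/-- The random vector `∑ l, A l (y l • b l + √(y l) • (B l 1 - b l))`, which for `y` in the
nonnegative orthant has the law of `multiparam A B y` and is jointly measurable in `y` and `ω`. -/
noncomputable def gaussianFamily (A : ∀ l, Matrix (Fin n) (Fin (k l)) ℝ) (b : ∀ l, Euc (k l))
    (B : ∀ l, ℝ≥0 → Ω → Euc (k l)) (y : Euc d) (ω : Ω) : Euc n :=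
  ∑ l, matVec (A l) (y l • b l + √(y l) • (B l 1 ω - b l))

lemma measurable_gaussianFamily (hB : ∀ l t, Measurable (B l t)) :
    Measurable fun p : Euc d × Ω => gaussianFamily A b B p.1 p.2 := by
  unfold gaussianFamily
  refine Finset.measurable_sum _ fun l _ => (measurable_matVec _).comp ?_
  have h2 : Measurable fun p : Euc d × Ω => B l 1 p.2 := (hB l 1).comp measurable_snd
  have h3 : Measurable fun p : Euc d × Ω => p.1 l := by fun_prop
  exact (h3.smul_const _).add ((h3.sqrt).smul (h2.sub_const _))

lemma measurable_gaussianFamily_right (hB : ∀ l t, Measurable (B l t)) (y : Euc d) :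
    Measurable fun ω => gaussianFamily A b B y ω := by
  have h1 : Measurable fun ω : Ω => (y, ω) := measurable_prodMk_left
  have h2 : Measurable fun p : Euc d × Ω => gaussianFamily A b B p.1 p.2 :=
    measurable_gaussianFamily hB
  have h3 := h2.comp h1
  exact h3

lemma measurable_gaussianFamily_smul (hB : ∀ l t, Measurable (B l t)) (c : ℝ) :
    Measurable fun p : Euc d × Ω => gaussianFamily A b B (c • p.1) p.2 := by
  have h1 : Measurable fun p : Euc d × Ω => (c • p.1, p.2) :=
    (measurable_fst.const_smul c).prodMk measurable_snd
  have h2 : Measurable fun p : Euc d × Ω => gaussianFamily A b B p.1 p.2 :=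
    measurable_gaussianFamily hB
  have h3 := h2.comp h1
  exact h3

lemma integral_exp_gaussianFamily (hB_meas : ∀ l t, Measurable (B l t))
    (hB : ∀ l, IsBrownianMotion (B l) (b l) (C l) P)
    (hB_indep : iIndepFun (fun l ω (t : ℝ≥0) => B l t ω) P) {y : Euc d} (hy : ∀ l, 0 ≤ y l)
    (z : Euc n) :
    ∫ ω, Complex.exp (((⟪z, gaussianFamily A b B y ω⟫ : ℝ) : ℂ) * Complex.I) ∂P
      = Complex.exp (pairing (exponents A b C z) y) := by
  let f : ∀ l, (ℝ≥0 → Euc (k l)) → ℂ := fun l v =>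
    Complex.exp (((⟪z, matVec (A l) (y l • b l + √(y l) • (v 1 - b l))⟫ : ℝ) : ℂ) * Complex.I)
  have hf : ∀ l, Measurable (f l) := by
    intro l
    have h1 : Measurable fun v : ℝ≥0 → Euc (k l) => v 1 := measurable_pi_apply _
    fun_prop
  have hpath : ∀ l, Measurable (fun ω (t : ℝ≥0) => B l t ω) := fun l =>
    measurable_pi_lambda _ (hB_meas l)
  have h := (hB_indep.comp f hf).integral_fun_prod_eq_prod_integral
    (fun l => ((hf l).comp (hpath l)).aestronglyMeasurable)
  have e : ∀ ω, Complex.exp (((⟪z, gaussianFamily A b B y ω⟫ : ℝ) : ℂ) * Complex.I)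
      = ∏ l, (f l ∘ fun ω t => B l t ω) ω := by
    intro ω
    simp only [f, Function.comp_apply]
    rw [← Complex.exp_sum, ← Finset.sum_mul, ← Complex.ofReal_sum, gaussianFamily, inner_sum]
  simp_rw [e]
  rw [h, pairing, Complex.exp_sum]
  refine Finset.prod_congr rfl fun l _ => ?_
  -- Brownian scaling: evaluating at `√(y l) • z` gives covariance `y l • C l` but drift only `√(y
  -- l) • b l`; the deterministic factor in `e2` supplies the missing `(y l - √(y l)) • b l`.
  have h1 := (hB l).integral_exp (A l) (√(y l) • z) 1
  rw [NNReal.coe_one, Complex.ofReal_one, one_mul] at h1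
  have e2 : ∀ ω, f l (fun t => B l t ω)
      = Complex.exp ((((y l - √(y l)) * ⟪z, matVec (A l) (b l)⟫ : ℝ) : ℂ) * Complex.I)
        * Complex.exp (((⟪√(y l) • z, matVec (A l) (B l 1 ω)⟫ : ℝ) : ℂ) * Complex.I) := by
    intro ω
    simp only [f]
    rw [← Complex.exp_add, ← add_mul, ← Complex.ofReal_add]
    congr 3
    simp only [matVec_add, matVec_sub, matVec_smul, inner_add_right, inner_sub_right,
      real_inner_smul_right, real_inner_smul_left]
    ring
  simp only [Function.comp_apply, e2]
  rw [integral_const_mul, h1, ← Complex.exp_add]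
  congr 1
  have hs : ((√(y l) : ℝ) : ℂ) * ((√(y l) : ℝ) : ℂ) = (y l : ℂ) := by
    rw [← Complex.ofReal_mul, Real.mul_self_sqrt (hy l)]
  simp only [exponents, brownianExponent, inner_matVec, matVec_smul, real_inner_smul_left,
    WithLp.ofLp_smul, Matrix.mulVec_smul, dotProduct_smul, smul_dotProduct, smul_eq_mul]
  push_cast
  rw [← hs]
  ring

lemma integral_exp_gaussianFamily_sub_one [IsProbabilityMeasure P]
    (hB_meas : ∀ l t, Measurable (B l t)) (hB : ∀ l, IsBrownianMotion (B l) (b l) (C l) P)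
    (hB_indep : iIndepFun (fun l ω (t : ℝ≥0) => B l t ω) P) {y : Euc d} (hy : ∀ l, 0 ≤ y l)
    (z : Euc n) :
    ∫ ω, (Complex.exp (((⟪z, gaussianFamily A b B y ω⟫ : ℝ) : ℂ) * Complex.I) - 1) ∂P
      = Complex.exp (pairing (exponents A b C z) y) - 1 := by
  have hm := measurable_gaussianFamily_right (A := A) (b := b) hB_meas y
  have hi : Integrable (fun ω =>
      Complex.exp (((⟪z, gaussianFamily A b B y ω⟫ : ℝ) : ℂ) * Complex.I)) P := by
    refine Integrable.of_bound (C := 1) (Measurable.aestronglyMeasurable (by fun_prop))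
      (Eventually.of_forall fun ω => ?_)
    rw [Complex.norm_exp_ofReal_mul_I]
  have h := integral_exp_gaussianFamily (A := A) hB_meas hB hB_indep hy z
  rw [integral_sub hi (integrable_const 1), h]
  simp

lemma IsBrownianMotion.memLp_two {m : ℕ} {B : ℝ≥0 → Ω → Euc m} {b : Euc m}
    {C : Matrix (Fin m) (Fin m) ℝ} (hB : IsBrownianMotion B b C P) :
    MemLp (B 1) 2 P := by
  have hlaw := hB.hasLaw_increment 0 1 zero_le_one
  have h1 : MemLp (fun ω => B 1 ω - B 0 ω) 2 P := by
    have h2 : MemLp id 2 (P.map fun ω => B 1 ω - B 0 ω) := by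
      rw [hlaw.map_eq]
      exact IsGaussian.memLp_two_id
    exact (memLp_map_measure_iff aestronglyMeasurable_id hlaw.aemeasurable).1 h2
  exact h1.ae_eq (hB.ae_sub_zero 1)

lemma IsBrownianMotion.memLp_two_matVec_sub [IsProbabilityMeasure P] {m : ℕ}
    {B : ℝ≥0 → Ω → Euc m} {b : Euc m} {C : Matrix (Fin m) (Fin m) ℝ}
    (hB : IsBrownianMotion B b C P) (A : Matrix (Fin n) (Fin m) ℝ) :
    MemLp (fun ω => matVec A (B 1 ω - b)) 2 P := by
  have h1 : MemLp (fun ω => B 1 ω - b) 2 P := (hB.memLp_two).sub (memLp_const b)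
  exact (Matrix.toEuclideanLin A).toContinuousLinearMap.comp_memLp' h1

/-- For `‖y‖ ≤ 1` both drift and fluctuation are at most `√‖y‖` times a square-integrable variable.
Squaring turns first-order integrability of `ν` into the second-order condition for the mixture. -/
lemma integrable_min_norm_gaussianFamily [IsProbabilityMeasure P]
    (hB_meas : ∀ l t, Measurable (B l t)) (hB : ∀ l, IsBrownianMotion (B l) (b l) (C l) P)
    {ν : Measure (Euc d)} [SFinite ν] (hν : Integrable (fun x : Euc d => min 1 ‖x‖) ν)
    {c : ℝ} (hc : 0 ≤ c) :
    Integrable (fun p : Euc d × Ω => min 1 (‖gaussianFamily A b B (c • p.1) p.2‖ ^ 2))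
      (ν.prod P) := by
  let R : Ω → ℝ := fun ω => ∑ l, (‖matVec (A l) (b l)‖ + ‖matVec (A l) (B l 1 ω - b l)‖)
  have hR : MemLp R 2 P := by
    have h2 : ∀ l, MemLp (fun ω => ‖matVec (A l) (b l)‖
        + ‖matVec (A l) (B l 1 ω - b l)‖) 2 P := by
      intro l
      have h3 : MemLp (fun ω => ‖matVec (A l) (B l 1 ω - b l)‖) 2 P :=
        ((hB l).memLp_two_matVec_sub (A l)).norm
      have h4 : MemLp (fun _ : Ω => ‖matVec (A l) (b l)‖) 2 P := memLp_const _
      exact h4.add h3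
    exact memLp_finsetSum _ fun l _ => h2 l
  have hbound : ∀ (y : Euc d) ω,
      min 1 (‖gaussianFamily A b B y ω‖ ^ 2) ≤ min 1 ‖y‖ * (1 + R ω ^ 2) := by
    intro y ω
    rcases le_total 1 ‖y‖ with h | h
    · rw [min_eq_left h, one_mul]
      exact (min_le_left _ _).trans (by linarith [sq_nonneg (R ω)])
    · rw [min_eq_right h]
      refine (min_le_right _ _).trans ?_
      have hn : ‖gaussianFamily A b B y ω‖ ≤ √‖y‖ * R ω := by
        simp only [gaussianFamily, R, Finset.mul_sum]
        refine norm_sum_le_of_le _ fun l _ => ?_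
        rw [matVec_add, matVec_smul, matVec_smul, mul_add]
        have hyl : |y l| ≤ ‖y‖ := PiLp.norm_apply_le y l
        have h0 := norm_nonneg y
        have h2 : ‖y‖ ≤ √‖y‖ := by
          refine Real.le_sqrt_of_sq_le ?_
          nlinarith
        refine (norm_add_le _ _).trans (add_le_add ?_ ?_)
        · rw [norm_smul]
          gcongr
          exact hyl.trans h2
        · rw [norm_smul, Real.norm_of_nonneg (Real.sqrt_nonneg _)]
          gcongr
          exact (le_abs_self _).trans hyl
      calc _ ≤ (√‖y‖ * R ω) ^ 2 := by gcongr
        _ = ‖y‖ * R ω ^ 2 := by rw [mul_pow, Real.sq_sqrt (norm_nonneg y)]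
        _ ≤ _ := by nlinarith [norm_nonneg y]
  have hprod : Integrable (fun p : Euc d × Ω => ((1 + c) * min 1 ‖p.1‖) * (1 + R p.2 ^ 2))
      (ν.prod P) :=
    (hν.const_mul (1 + c)).mul_prod ((integrable_const 1).add hR.integrable_sq)
  refine hprod.mono' ?_ (Eventually.of_forall fun p => ?_)
  · have h1 := measurable_gaussianFamily_smul (A := A) (b := b) hB_meas c
    exact (measurable_const.min (h1.norm.pow_const 2)).aestronglyMeasurable
  · rw [Real.norm_of_nonneg (by positivity)]
    refine (hbound _ _).trans ?_
    have h1 : min 1 ‖c • p.1‖ ≤ (1 + c) * min 1 ‖p.1‖ := by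
      rw [norm_smul, Real.norm_of_nonneg hc]
      rcases le_total 1 ‖p.1‖ with h | h
      · rw [min_eq_left h]
        exact (min_le_left _ _).trans (by linarith)
      · rw [min_eq_right h]
        exact (min_le_right _ _).trans (by nlinarith [norm_nonneg p.1])
    gcongr

end gaussianFamily

/-! ### Sato subordination -/

section sato
variable {Ω : Type*} [MeasurableSpace Ω] {P : Measure Ω} {d n : ℕ}
  {α q : ℝ} {β : UnitSphere d → ℝ} {lam : Measure (UnitSphere d)} {S : ℝ≥0 → Ω → Euc d}

instance instSFiniteEtsLevyMeasure [SFinite lam] : SFinite (etsLevyMeasure α β lam) := by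
  unfold etsLevyMeasure
  infer_instance

lemma IsDriftlessETS.integrable_min_norm {μ : Measure (Euc d)} (h : IsDriftlessETS μ α β lam) :
    Integrable (fun x : Euc d => min 1 ‖x‖) (etsLevyMeasure α β lam) :=
  h.hasLevyTriplet.isLevyMeasure.integrable_min_norm h.integrableOn

lemma IsDriftlessETS.charFun_eq {μ : Measure (Euc d)} (h : IsDriftlessETS μ α β lam)
    (z : Euc d) : charFun μ z = Complex.exp (∫ x,
      (Complex.exp (((⟪z, x⟫ : ℝ) : ℂ) * Complex.I) - 1) ∂(etsLevyMeasure α β lam)) := by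
  rw [h.hasLevyTriplet.charFun_eq, integral_exp_inner_sub_one h.integrableOn
    (h.hasLevyTriplet.isLevyMeasure.integrable_levyIntegrand z)]
  simp

/-- Self-similarity determines the one-dimensional marginals of a Sato process. -/
lemma IsSatoProcess.identDistrib (hS : IsSatoProcess S q P) (hq : 0 < q)
    (hS_meas : ∀ t, Measurable (S t)) (t : ℝ≥0) :
    IdentDistrib (S t) (fun ω => ((t : ℝ) ^ q) • S 1 ω) P P := by
  -- Self-similarity needs a positive scale; at time zero both sides vanish since `0 ^ q = 0` for `q
  -- > 0`.
  rcases eq_or_ne t 0 with rfl | ht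
  · refine IdentDistrib.of_ae_eq (hS_meas 0).aemeasurable ?_
    filter_upwards [hS.isAdditiveProcess.start_zero] with ω hω
    rw [hω, NNReal.coe_zero, Real.zero_rpow hq.ne', zero_smul]
  · have h := (hS.selfSimilar t (pos_iff_ne_zero.2 ht)).comp
      (measurable_pi_apply (1 : ℝ≥0) : Measurable fun v : ℝ≥0 → Euc d => v 1)
    simpa [Function.comp_def] using h

/-- Self-similarity trades the time `t` for the factor `t ^ q` on the exponent, which leaves the
extended Laplace transform of `S 1`. -/
lemma IsSatoSubordinator.integral_exp_pairing [IsProbabilityMeasure P] [IsFiniteMeasure lam]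
    (hq : 0 < q) (hlam : ∀ᵐ w : UnitSphere d ∂lam, ∀ i, 0 ≤ (w : Euc d) i)
    (hS_meas : ∀ t, Measurable (S t)) (hS : IsSatoSubordinator S q P)
    (hS_one : IsDriftlessETS (P.map (S 1)) α β lam) (t : ℝ≥0) {u : Fin d → ℂ}
    (hu : ∀ l, (u l).re ≤ 0) :
    ∫ ω, Complex.exp (pairing u (S t ω)) ∂P
      = Complex.exp (∫ x, (Complex.exp (pairing (fun l => (((t : ℝ) ^ q : ℝ) : ℂ) * u l) x) - 1)
        ∂(etsLevyMeasure α β lam)) := by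
  have hprob : IsProbabilityMeasure (P.map (S 1)) :=
    Measure.isProbabilityMeasure_map (hS_meas 1).aemeasurable
  have hm : MeasurableSet {x : Euc d | ∀ i, 0 ≤ x i} := by
    rw [Set.ofPred_forall]
    exact MeasurableSet.iInter fun i => measurableSet_le measurable_const (by fun_prop)
  have hpos : ∀ᵐ x ∂(P.map (S 1)), ∀ i, 0 ≤ x i := by
    rw [ae_map_iff (hS_meas 1).aemeasurable hm]
    filter_upwards [hS.nonneg] with ω hω using hω 1
  have hv : ∀ l, ((((t : ℝ) ^ q : ℝ) : ℂ) * u l).re ≤ 0 := by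
    intro l
    rw [Complex.re_ofReal_mul]
    exact mul_nonpos_of_nonneg_of_nonpos (by positivity) (hu l)
  have h1 := integral_exp_pairing_eq hpos (ae_nonneg_etsLevyMeasure hlam)
    hS_one.integrable_min_norm hS_one.charFun_eq hv
  rw [← h1, integral_map (hS_meas 1).aemeasurable
    (Continuous.aestronglyMeasurable (by fun_prop))]
  have h2 := ((hS.isSatoProcess.identDistrib hq hS_meas t).comp
    (continuous_pairing u).cexp.measurable).integral_eq
  simp only [Function.comp_apply] at h2
  rw [h2]
  simp only [pairing_smul, pairing_smul_left]

end sato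
end SatoSub

/-! ### Additivity, pure jumps and the characteristic function of the subordinated process -/

open SatoSub in
theorem theorem4p1 {Ω : Type*} [MeasurableSpace Ω] (P : Measure Ω) [IsProbabilityMeasure P]
    {d n : ℕ} {k : Fin d → ℕ}
    -- the Sato subordinator and its parameters
    (α q : ℝ) (hα0 : 0 < α) (hα1 : α < 1) (hq : 0 < q)
    (β : UnitSphere d → ℝ) (hβ : Measurable β) (hβ_pos : ∀ w, 0 < β w)
    (lam : Measure (UnitSphere d)) [IsFiniteMeasure lam]
    (hlam : ∀ᵐ w : UnitSphere d ∂lam, ∀ i, 0 ≤ (w : Euc d) i)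
    (S : ℝ≥0 → Ω → Euc d) (hS_meas : ∀ t, Measurable (S t))
    (hS : IsSatoSubordinator S q P) (hS_one : IsDriftlessETS (P.map (S 1)) α β lam)
    -- the multiparameter Brownian motion
    (b : ∀ l, Euc (k l)) (C : ∀ l, Matrix (Fin (k l)) (Fin (k l)) ℝ)
    (B : ∀ l, ℝ≥0 → Ω → Euc (k l)) (hB_meas : ∀ l t, Measurable (B l t))
    (hB : ∀ l, IsBrownianMotion (B l) (b l) (C l) P)
    (hB_indep : iIndepFun (fun l ω (t : ℝ≥0) => B l t ω) P)
    (A : ∀ l, Matrix (Fin n) (Fin (k l)) ℝ)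
    (hSB : IndepFun (fun ω (t : ℝ≥0) => S t ω)
      (fun ω (s : Fin d → ℝ≥0) => multiparam A B s ω) P) :
    IsAdditiveProcess (subordinated (multiparam A B) S) P ∧
    IsPureJump (subordinated (multiparam A B) S) P ∧
    ∀ (t : ℝ≥0) (z : Euc n),
      Integrable (fun w : UnitSphere d =>
        (((β w : ℝ) : ℂ) - (((t : ℝ) ^ q : ℝ) : ℂ) *
          ∑ l, distinguishedLog (charFun (P.map (fun ω => matVec (A l) (B l 1 ω)))) z *
            (((w : Euc d) l : ℝ) : ℂ)) ^ (α : ℂ) - ((β w ^ α : ℝ) : ℂ)) lam ∧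
      charFun (P.map (subordinated (multiparam A B) S t)) z =
        Complex.exp (((Real.Gamma (-α) : ℝ) : ℂ) *
          ∫ w : UnitSphere d,
            ((((β w : ℝ) : ℂ) - (((t : ℝ) ^ q : ℝ) : ℂ) *
              ∑ l, distinguishedLog (charFun (P.map (fun ω => matVec (A l) (B l 1 ω)))) z *
                (((w : Euc d) l : ℝ) : ℂ)) ^ (α : ℂ) - ((β w ^ α : ℝ) : ℂ)) ∂lam) := by
  have h : IsSubordination P S b C B A :=
    ⟨hS_meas, hS.nonneg, hS.monotone, hB_meas, hB, hB_indep, hSB⟩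
  have hadd := hS.isSatoProcess.isAdditiveProcess
  have hmin := hS_one.integrable_min_norm
  have hν0 := ae_nonneg_etsLevyMeasure (α := α) (β := β) hlam
  have hre : ∀ (t : ℝ≥0) (z : Euc n) l,
      ((((t : ℝ) ^ q : ℝ) : ℂ) * exponents A b C z l).re ≤ 0 := by
    intro t z l
    rw [Complex.re_ofReal_mul]
    exact mul_nonpos_of_nonneg_of_nonpos (by positivity) (h.re_exponents_nonpos z l)
  have hchar : ∀ (t : ℝ≥0) z, charFun (P.map (subordinated (multiparam A B) S t)) z
      = Complex.exp (∫ x, (Complex.exp (pairing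
        (fun l => (((t : ℝ) ^ q : ℝ) : ℂ) * exponents A b C z l) x) - 1)
        ∂(etsLevyMeasure α β lam)) := by
    intro t z
    rw [h.charFun_subordinated hadd.start_zero t z]
    exact hS.integral_exp_pairing hq hlam hS_meas hS_one t (h.re_exponents_nonpos z)
  refine ⟨h.isAdditiveProcess_subordinated hadd, fun t => ?_, fun t z => ?_⟩
  · have hc : (0 : ℝ) ≤ (t : ℝ) ^ q := by positivity
    -- The Lévy measure at time `t` mixes the laws of `B_A(t^q x)` over `ν(dx)`, the scaling by `t ^
    -- q` being that of `S`.
    have hW := measurable_gaussianFamily_smul (A := A) (b := b) hB_meas ((t : ℝ) ^ q)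
    have hWmin := integrable_min_norm_gaussianFamily (A := A) hB_meas hB hmin hc
    have hinner : ∀ z : Euc n, (fun x => ∫ ω, (Complex.exp
        (((⟪z, gaussianFamily A b B (((t : ℝ) ^ q) • x) ω⟫ : ℝ) : ℂ) * Complex.I) - 1) ∂P)
        =ᵐ[etsLevyMeasure α β lam] fun x => Complex.exp (pairing
        (fun l => (((t : ℝ) ^ q : ℝ) : ℂ) * exponents A b C z l) x) - 1 := by
      intro z
      filter_upwards [hν0] with x hx
      have hcx : ∀ l, 0 ≤ (((t : ℝ) ^ q) • x) l := fun l => mul_nonneg hc (hx l)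
      have h1 := integral_exp_gaussianFamily_sub_one (A := A) hB_meas hB hB_indep hcx z
      rw [h1, pairing_smul, pairing_smul_left]
    refine exists_hasLevyTriplet_mixture hW hWmin (fun z => ?_) (fun z => ?_)
    · exact (integrable_exp_pairing_sub_one hν0 hmin (hre t z)).congr (hinner z).symm
    · rw [hchar t z, integral_congr_ae (hinner z)]
  · have hlog : ∀ l, distinguishedLog (charFun (P.map (fun ω => matVec (A l) (B l 1 ω)))) z
        = exponents A b C z l := fun l =>
      congrFun ((hB l).distinguishedLog_charFun (hB_meas l 1) (A l)) z
    simp_rw [hlog]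
    have hL := laplaceExponent_ets hα0 hα1 hβ hβ_pos hlam hmin (hre t z)
    rw [hchar t z, hL.2]
    simp only [pairing_smul_left] at hL ⊢
    exact ⟨hL.1, rfl⟩
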